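/- Let $(w_{ij})_{i,j\ge 1}$ be independent real random variables on a probability space $(\Omega_w,\mathcal F_w,\mathbb P_w)$ with $\mathbb E_w w_{ij}=0$, $\mathbb E_w w_{ij}^2=1$ and $\mathbb E_w|w_{ij}|^{p}\le K$ for all $i,j$, where $p>12$ and $K<\infty$ do not depend on $i,j$. Fix $\xi>0$, and for $N\ge 1$ let $M=M(N)=\lfloor \xi N\rfloor$. An up-right path in the rectangle $\{1,\dots,M\}\times\{1,\dots,N\}$ is a set of squares $\{(i_k,j_k): k=1,\dots,M+N-1\}$ with $(i_1,j_1)=(1,1)$, $(i_{M+N-1},j_{M+N-1})=(M,N)$, and $(i_{k+1}-i_k,\,j_{k+1}-j_k)\in\{(1,0),(0,1)\}$ for all $1\le k<M+N-1$. For each $N$ with $M(N)\ge 1$ let $\sigma=\sigma_N$, defined on a further probability space with probability measure $\mathbb P_\sigma$ (and thus independent of the environment), be uniformly distributed on the set of all up-right paths in this rectangle. Then for $\mathbb P_w$-almost every environment $w=(w_{ij})$, $$\frac{1}{\sqrt{M+N-1}}\sum_{(i,j)\in\sigma_N} w_{ij}\ \longrightarrow\ \mathcal N(0,1)\qquad\text{as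 } N\to\infty$$ in distribution with respect to $\mathbb P_\sigma$, with $w$ fixed. -/

import Mathlib

open MeasureTheory ProbabilityTheory Filter

/-- The finite set of squares `σ` is (the trace of) an up-right path from `(1,1)` to `(M,N)`:
it is the set of squares visited by a sequence `c 0, c 1, ..., c (M+N-2)` of `M+N-1` squares of the
quadrant `{1,2,...} × {1,2,...}` which starts at `(1,1)`, ends at `(M,N)`, and at each step
increases exactly one of the two coordinates by one.
There is no such path when `M = 0` or `N = 0`. -/
def IsUpRightPath (M N : ℕ) (σ : Finset (ℕ+ × ℕ+)) : Prop :=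
  ∃ c : ℕ → ℕ+ × ℕ+,
    c 0 = (1, 1) ∧
    ((c (M + N - 2)).1 : ℕ) = M ∧ ((c (M + N - 2)).2 : ℕ) = N ∧
    (∀ k, k + 1 < M + N - 1 →
      c (k + 1) = ((c k).1 + 1, (c k).2) ∨ c (k + 1) = ((c k).1, (c k).2 + 1)) ∧
    σ = (Finset.range (M + N - 1)).image c

/-- The set of all up-right paths in the rectangle `{1,...,M} × {1,...,N}`. -/
def upRightPaths (M N : ℕ) : Set (Finset (ℕ+ × ℕ+)) :=
  {σ | IsUpRightPath M N σ}

/-- The random path `σ` on the probability space `(Ω, P)` is uniformly distributed on the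
(finite) set of up-right paths in the rectangle `{1,...,M} × {1,...,N}`: each of these paths is
taken with probability one over their number. -/
def IsUniformUpRightPath (M N : ℕ) {Ω : Type*} [MeasurableSpace Ω] (P : Measure Ω)
    (σ : Ω → Finset (ℕ+ × ℕ+)) : Prop :=
  ∀ π ∈ upRightPaths M N, P {s | σ s = π} = ((upRightPaths M N).ncard : ENNReal)⁻¹

/-- The energy of the path `σ` in the fixed environment `w`. -/
def pathEnergy (w : ℕ+ × ℕ+ → ℝ) (σ : Finset (ℕ+ × ℕ+)) : ℝ :=
  ∑ a ∈ σ, w a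

/-! Fix a bounded Lipschitz function `ψ`, write L = M + N - 1, and average `ψ` of the normalized
energy over all paths. This average is a function of the environment, and two facts show that it
converges almost surely to the Gaussian integral of `ψ`.

Its mean over the environment converges: each path sums L independent standardized variables, and
the CLT applies along any choice of paths, in particular the worst one for each N
(`tendsto_integral_quenched`).

It concentrates: its Lipschitz constant in the weight of a square is of order L^(-1/2) times the
probability that a path visits that square. The squared visit probabilities sum to the expected
overlap of two independent paths, which is O(√L) by anti-concentration of hypergeometric weights
(`hyp_div_le`, `sum_visitProb_sq_le`). The squared Lipschitz constants therefore sum to O(L^(-1/2)),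
and `integral_sub_integral_pow_six_le` bounds the sixth central moment by O(L^(-3/2)). This is
summable, whereas the analogous fourth-moment rate 1/L would not be.

Countably many Lipschitz functions determine weak convergence on the line
(`tendsto_of_forall_integral_testFun`), so a single null set of environments suffices. -/

/-! ### Hypergeometric weights: moments and anti-concentration -/

/-- The number of `m`-subsets of a set of size `d + r` with exactly `i ≤ m` elements in a
given subset of size `d`. -/
def hyp (d r m i : ℕ) : ℝ := (d.choose i : ℝ) * (r.choose (m - i) : ℝ)

lemma hyp_nonneg (d r m i : ℕ) : 0 ≤ hyp d r m i := by unfold hyp; positivity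

lemma hyp_symm (d r : ℕ) {m i : ℕ} (hi : i ≤ m) : hyp d r m i = hyp r d m (m - i) := by
  unfold hyp
  rw [Nat.sub_sub_self hi, mul_comm]

lemma sum_hyp (d r m : ℕ) :
    ∑ i ∈ Finset.range (m + 1), hyp d r m i = ((d + r).choose m : ℝ) := by
  rw [Nat.add_choose_eq, Finset.Nat.sum_antidiagonal_eq_sum_range_succ_mk]
  push_cast
  rfl

lemma cast_choose_succ_mul (n k : ℕ) :
    (n.choose (k + 1) : ℝ) * (k + 1) = (n.choose k : ℝ) * (n - k) := by
  have h := Nat.choose_succ_right_eq n k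
  rcases le_or_gt k n with hk | hk
  · have := congrArg (Nat.cast : ℕ → ℝ) h
    push_cast [Nat.cast_sub hk] at this
    exact this
  · rw [Nat.choose_eq_zero_of_lt hk, Nat.choose_eq_zero_of_lt (by lia)]
    simp

/-- Both the moments and the decay beyond the mode come from this ratio identity. The subtraction `r
- m` is real and may be negative; the identity survives because the relevant weights vanish there.
-/
lemma hyp_succ (d r : ℕ) {m i : ℕ} (hi : i < m) :
    hyp d r m (i + 1) * ((i + 1) * (r - m + i + 1)) = hyp d r m i * ((d - i) * (m - i)) := by
  have h1 := cast_choose_succ_mul d i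
  have h2 := cast_choose_succ_mul r (m - (i + 1))
  have h3 : m - (i + 1) + 1 = m - i := by lia
  rw [h3, Nat.cast_sub (by lia : i + 1 ≤ m)] at h2
  push_cast at h2
  unfold hyp
  linear_combination (r.choose (m - (i + 1)) : ℝ) * (r - m + i + 1) * h1
    - (d.choose i : ℝ) * (d - i) * h2

/-- Summation by parts for the hypergeometric weights. -/
lemma sum_hyp_mul (d r m : ℕ) (f : ℕ → ℝ) :
    ∑ i ∈ Finset.range (m + 1), hyp d r m i * ((d - i) * (m - i)) * f (i + 1) =
      ∑ i ∈ Finset.range (m + 1), hyp d r m i * (i * (r - m + i)) * f i := by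
  rw [Finset.sum_range_succ, Finset.sum_range_succ' (fun i => hyp d r m i * (i * (r - m + i)) * f i)]
  simp only [sub_self, mul_zero, zero_mul, add_zero, Nat.cast_zero]
  refine Finset.sum_congr rfl fun i hi => ?_
  rw [← hyp_succ d r (Finset.mem_range.1 hi)]
  push_cast
  ring

lemma sum_hyp_mul_id (d r m : ℕ) :
    ((d : ℝ) + r) * ∑ i ∈ Finset.range (m + 1), hyp d r m i * i =
      d * m * ((d + r).choose m : ℝ) := by
  have h := sum_hyp_mul d r m (fun _ => 1)
  rw [← sub_eq_zero, ← Finset.sum_sub_distrib] at h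
  rw [← sum_hyp, Finset.mul_sum, Finset.mul_sum, ← sub_eq_zero, ← Finset.sum_sub_distrib,
    ← neg_eq_zero, ← Finset.sum_neg_distrib, ← h]
  refine Finset.sum_congr rfl fun i _ => ?_
  ring

lemma sum_hyp_mul_sq (d r m : ℕ) :
    ((d : ℝ) + r - 1) * ∑ i ∈ Finset.range (m + 1), hyp d r m i * i ^ 2 =
      d * m * ((d + r).choose m : ℝ)
        + (d * m - d - m) * ∑ i ∈ Finset.range (m + 1), hyp d r m i * i := by
  have h := sum_hyp_mul d r m (fun i => i)
  rw [← sub_eq_zero, ← Finset.sum_sub_distrib] at h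
  rw [← sum_hyp, Finset.mul_sum, Finset.mul_sum, Finset.mul_sum, ← Finset.sum_add_distrib,
    ← sub_eq_zero, ← Finset.sum_sub_distrib,
    ← neg_eq_zero, ← Finset.sum_neg_distrib, ← h]
  refine Finset.sum_congr rfl fun i _ => ?_
  push_cast
  ring

/-- Second moment of the hypergeometric weights about `(d+1)(m+1)/(d+r+2) - 1`. -/
lemma sum_hyp_mul_sq_sub_le (d r m : ℕ) (hn : 2 ≤ d + r) (hm : m ≤ d + r) :
    ∑ i ∈ Finset.range (m + 1), hyp d r m i * (i + 1 - (d + 1) * (m + 1) / (d + r + 2)) ^ 2 ≤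
      ((d + r).choose m : ℝ) * (3 * ((d + 1) * (r + 1)) / (d + r + 2)) := by
  have hT := sum_hyp d r m
  have h1 := sum_hyp_mul_id d r m
  have h2 := sum_hyp_mul_sq d r m
  set T : ℝ := ((d + r).choose m : ℝ)
  set S1 := ∑ i ∈ Finset.range (m + 1), hyp d r m i * i
  set S2 := ∑ i ∈ Finset.range (m + 1), hyp d r m i * i ^ 2
  have hT0 : 0 ≤ T := by positivity
  set μ : ℝ := (d + 1) * (m + 1) / (d + r + 2) with hμ
  have hexp : ∑ i ∈ Finset.range (m + 1), hyp d r m i * (i + 1 - μ) ^ 2 =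
      S2 + 2 * (1 - μ) * S1 + (1 - μ) ^ 2 * T := by
    rw [← hT, Finset.mul_sum, Finset.mul_sum, ← Finset.sum_add_distrib, ← Finset.sum_add_distrib]
    refine Finset.sum_congr rfl fun i _ => ?_
    ring
  rw [hexp]
  obtain ⟨k, hk⟩ := Nat.exists_eq_add_of_le hm
  have hk' : (d : ℝ) + r = m + k := by exact_mod_cast hk
  have hn' : (2 : ℝ) ≤ d + r := by exact_mod_cast hn
  have hd0 : (0 : ℝ) ≤ d := by positivity
  have hr0 : (0 : ℝ) ≤ r := by positivity
  have hm0 : (0 : ℝ) ≤ m := by positivity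
  have hk0 : (0 : ℝ) ≤ k := by positivity
  have hS1 : S1 = d * m * T / (d + r) := by
    rw [eq_div_iff (by positivity)]; linarith
  have hS2 : S2 = (d * m * T + (d * m - d - m) * S1) / (d + r - 1) := by
    rw [eq_div_iff (by linarith)]; linarith
  set n : ℝ := d + r with hnn
  have hr : (r : ℝ) = n - d := by rw [hnn]; ring
  have hkk : (k : ℝ) = n - m := by linarith
  -- Hypergeometric variance plus the squared distance from the mean to `μ - 1`. That distance lies
  -- in [0, 1], and `hone` absorbs it into twice the target quantity, whence the constant 3 = 1 + 2.
  have hvar : S2 + 2 * (1 - μ) * S1 + (1 - μ) ^ 2 * T =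
      T * (d * r * (m * k) / (n ^ 2 * (n - 1)) + ((r * k + d * m + n) / (n * (n + 2))) ^ 2) := by
    have : n ≠ 0 := by linarith
    have : n - 1 ≠ 0 := by linarith
    have : n + 2 ≠ 0 := by linarith
    rw [hS2, hS1, hμ, hr, hkk]
    field_simp
    ring
  rw [hvar]
  refine mul_le_mul_of_nonneg_left ?_ hT0
  have hb : (r * k + d * m + n) / (n * (n + 2)) ≤ 1 := by
    rw [div_le_one (by positivity)]
    rw [hr] at hr0 ⊢
    rw [hkk] at hk0 ⊢
    linarith [mul_nonneg hr0 hm0, mul_nonneg hd0 hk0,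
      (by ring : n * (n + 2) - ((n - d) * (n - m) + d * m + n)
        = (n - d) * m + d * (n - m) + n)]
  have hb0 : 0 ≤ (r * k + d * m + n) / (n * (n + 2)) := by positivity
  have hv : d * r * (m * k) / (n ^ 2 * (n - 1)) ≤ (d + 1) * (r + 1) / (n + 2) := by
    have hmk : 4 * ((m : ℝ) * k) ≤ n ^ 2 := by
      rw [hkk]; nlinarith [sq_nonneg (n - 2 * m)]
    have h4 : n + 2 ≤ 4 * (n - 1) := by linarith
    rw [div_le_div_iff₀ (mul_pos (pow_pos (by linarith) 2) (by linarith)) (by linarith)]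
    calc (d : ℝ) * r * (m * k) * (n + 2) ≤ d * r * (m * k) * (4 * (n - 1)) := by gcongr
      _ = d * r * (n - 1) * (4 * (m * k)) := by ring
      _ ≤ d * r * (n - 1) * n ^ 2 := by
        have : 0 ≤ n - 1 := by linarith
        gcongr
      _ ≤ (d + 1) * (r + 1) * (n - 1) * n ^ 2 := by
        have : 0 ≤ n - 1 := by linarith
        gcongr <;> linarith
      _ = _ := by ring
  have hone : 1 ≤ 2 * ((d + 1) * (r + 1)) / (n + 2) := by
    rw [le_div_iff₀ (by linarith)]
    linarith [mul_nonneg hd0 hr0,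
      (by ring : 2 * (((d : ℝ) + 1) * (r + 1)) = 2 * (d * r) + (d + r) + (d + r) + 2)]
  have : 3 * ((d + 1) * (r + 1)) / (n + 2)
      = (d + 1) * (r + 1) / (n + 2) + 2 * (((d : ℝ) + 1) * (r + 1)) / (n + 2) := by ring
  rw [this]
  linarith [pow_le_one₀ hb0 hb (n := 2)]

/-- The right side changes sign at `i + 1 = (d+1)(m+1)/(d+r+2)`, which locates the mode. This is why
deviations are measured from that point rather than from the mean. -/
lemma hyp_sub_hyp_succ (d r : ℕ) {m i : ℕ} (hi : i < m) :
    (hyp d r m i - hyp d r m (i + 1)) * ((i + 1) * (r - m + i + 1)) =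
      hyp d r m i * ((d + r + 2) * (i + 1) - (d + 1) * (m + 1)) := by
  rw [sub_mul, hyp_succ d r hi]
  ring

/-- Beyond the mode, the hypergeometric weights are controlled by the first absolute moment. -/
lemma hyp_le_sum_of_le (d r m k i : ℕ) (hk : d + r = m + k) (hi : i ≤ m)
    (h : ((d : ℝ) + 1) * (m + 1) / (d + r + 2) ≤ i + 1) :
    hyp d r m i ≤ (d + r + 2) ^ 3 / ((d + 1) * (m + 1) * (r + 1) * (k + 1)) *
      ∑ j ∈ Finset.range (m + 1), hyp d r m j * |(j : ℝ) + 1 - (d + 1) * (m + 1) / (d + r + 2)| := by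
  set μ : ℝ := ((d : ℝ) + 1) * (m + 1) / (d + r + 2) with hμ
  set c : ℝ := ((d : ℝ) + r + 2) ^ 3 / ((d + 1) * (m + 1) * (r + 1) * (k + 1)) with hc
  have hk' : (k : ℝ) = d + r - m := by
    have : (d : ℝ) + r = m + k := by exact_mod_cast hk
    linarith
  have hk0 : (0 : ℝ) ≤ k := by positivity
  have hc0 : 0 ≤ c := by positivity
  have hn : (0 : ℝ) < d + r + 2 := by positivity
  have hμ0 : 0 < μ := by positivity
  have hν : ((r : ℝ) + 1) * (k + 1) / (d + r + 2) = r - m + μ := by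
    rw [hμ, hk']; field_simp; ring
  have hν0 : 0 < (r : ℝ) - m + μ := by rw [← hν]; positivity
  -- The constant `c` is fixed by this equation: beyond the mode the factor `(j+1)(r-m+j+1)` in the
  -- decrement identity is at least `μ(r-m+μ)`.
  have hcμ : c * (μ * (r - m + μ)) = d + r + 2 := by
    rw [← hν, hμ, hc]; field_simp
  have key : ∀ j : ℕ, i ≤ j → j < m →
      hyp d r m j - hyp d r m (j + 1) ≤ c * (hyp d r m j * |(j : ℝ) + 1 - μ|) := by
    intro j hij hjm
    have hij' : (i : ℝ) ≤ j := by exact_mod_cast hij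
    have e := hyp_sub_hyp_succ d r hjm
    have e2 : ((d : ℝ) + r + 2) * (j + 1) - (d + 1) * (m + 1) = (d + r + 2) * (j + 1 - μ) := by
      rw [hμ]; field_simp
    rw [e2] at e
    have hjμ : 0 ≤ (j : ℝ) + 1 - μ := by linarith
    have hpos : μ * (r - m + μ) ≤ ((j : ℝ) + 1) * (r - m + j + 1) := by
      apply mul_le_mul <;> linarith
    have hpos' : 0 < μ * (r - m + μ) := mul_pos hμ0 hν0
    have hh := hyp_nonneg d r m j
    rw [abs_of_nonneg hjμ]
    refine le_of_mul_le_mul_right ?_ (hpos'.trans_le hpos)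
    rw [e, ← hcμ]
    calc hyp d r m j * (c * (μ * (r - m + μ)) * (j + 1 - μ))
        = c * (hyp d r m j * (j + 1 - μ)) * (μ * (r - m + μ)) := by ring
      _ ≤ _ := by gcongr
  have tel : ∀ l : ℕ, i ≤ l → l ≤ m → hyp d r m i ≤ hyp d r m l +
      c * ∑ j ∈ Finset.Ico i l, hyp d r m j * |(j : ℝ) + 1 - μ| := by
    intro l hl
    induction l, hl using Nat.le_induction with
    | base => intro _; simp
    | succ l hl ih =>
      intro hlm
      rw [Finset.sum_Ico_succ_top hl, mul_add]
      linarith [ih (by lia), key l hl (by lia)]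
  -- The telescoping sum stops at the weight of `m`, which need not vanish; the term `j = m` of the
  -- moment sum absorbs it.
  have last : hyp d r m m ≤ c * (hyp d r m m * |(m : ℝ) + 1 - μ|) := by
    have h1 : (m : ℝ) + 1 - μ = (r + 1) * (m + 1) / (d + r + 2) := by
      rw [hμ]; field_simp; ring
    have h2 : 0 ≤ (m : ℝ) + 1 - μ := by rw [h1]; positivity
    rw [abs_of_nonneg h2, h1]
    have h3 : 1 ≤ c * (((r : ℝ) + 1) * (m + 1) / (d + r + 2)) := by
      have : c * (((r : ℝ) + 1) * (m + 1) / (d + r + 2))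
          = ((d : ℝ) + r + 2) ^ 2 / ((d + 1) * (k + 1)) := by
        rw [hc]; field_simp
      rw [this, one_le_div (by positivity), sq]
      have hm0 : (0 : ℝ) ≤ m := by positivity
      have hr0 : (0 : ℝ) ≤ r := by positivity
      have hd0 : (0 : ℝ) ≤ d := by positivity
      apply mul_le_mul <;> linarith
    have hh := hyp_nonneg d r m m
    calc hyp d r m m = hyp d r m m * 1 := (mul_one _).symm
      _ ≤ hyp d r m m * (c * (((r : ℝ) + 1) * (m + 1) / (d + r + 2))) := by gcongr
      _ = _ := by ring
  calc hyp d r m i ≤ hyp d r m m +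
        c * ∑ j ∈ Finset.Ico i m, hyp d r m j * |(j : ℝ) + 1 - μ| := tel m hi le_rfl
    _ ≤ c * ∑ j ∈ Finset.Ico i (m + 1), hyp d r m j * |(j : ℝ) + 1 - μ| := by
      rw [Finset.sum_Ico_succ_top hi, mul_add]
      linarith
    _ ≤ _ := by
      refine mul_le_mul_of_nonneg_left (Finset.sum_le_sum_of_subset_of_nonneg ?_ fun j _ _ =>
        mul_nonneg (hyp_nonneg _ _ _ _) (abs_nonneg _)) hc0
      intro j
      simp

/-- Cauchy–Schwarz with respect to the weights, applied to the second-moment bound. -/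
lemma sum_hyp_mul_abs_le (d r m : ℕ) (hn : 2 ≤ d + r) (hm : m ≤ d + r) :
    ∑ j ∈ Finset.range (m + 1), hyp d r m j * |(j : ℝ) + 1 - (d + 1) * (m + 1) / (d + r + 2)| ≤
      ((d + r).choose m : ℝ) * √(3 * ((d + 1) * (r + 1)) / (d + r + 2)) := by
  set μ : ℝ := ((d : ℝ) + 1) * (m + 1) / (d + r + 2) with hμ
  have hT := sum_hyp d r m
  have hV := sum_hyp_mul_sq_sub_le d r m hn hm
  set T : ℝ := ((d + r).choose m : ℝ)
  set V : ℝ := 3 * (((d : ℝ) + 1) * (r + 1)) / (d + r + 2)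
  have hT0 : 0 ≤ T := by positivity
  have cs := Finset.sum_sq_le_sum_mul_sum_of_sq_le_mul (Finset.range (m + 1))
    (r := fun j => hyp d r m j * |(j : ℝ) + 1 - μ|) (f := fun j => hyp d r m j)
    (g := fun j => hyp d r m j * ((j : ℝ) + 1 - μ) ^ 2)
    (fun j _ => hyp_nonneg _ _ _ _)
    (fun j _ => mul_nonneg (hyp_nonneg _ _ _ _) (sq_nonneg _))
    (fun j _ => by rw [mul_pow, sq_abs]; exact (by ring : _ = _).le)
  rw [hT] at cs
  refine abs_le_of_sq_le_sq' ?_ (by positivity) |>.2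
  rw [mul_pow, Real.sq_sqrt (by positivity)]
  refine cs.trans ?_
  rw [sq, mul_assoc]
  gcongr

/-- Anti-concentration of the hypergeometric distribution. -/
lemma hyp_div_le (d r m k i : ℕ) (hk : d + r = m + k) (hn : 2 ≤ d + r) (hi : i ≤ m)
    {c : ℝ} (hc : 0 < c) (hmc : c * (d + r + 2) ≤ m + 1) (hkc : c * (d + r + 2) ≤ k + 1) :
    hyp d r m i / (d + r).choose m ≤ 2 / c ^ 2 * (1 / √(d + 1) + 1 / √(r + 1)) := by
  have hm : m ≤ d + r := by lia
  have hT0 : (0 : ℝ) < (d + r).choose m := by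
    exact_mod_cast Nat.choose_pos hm
  have main : hyp d r m i ≤ (d + r + 2) ^ 3 / ((d + 1) * (m + 1) * (r + 1) * (k + 1)) *
      (((d + r).choose m : ℝ) * √(3 * ((d + 1) * (r + 1)) / (d + r + 2))) := by
    by_cases h : ((d : ℝ) + 1) * (m + 1) / (d + r + 2) ≤ i + 1
    · refine (hyp_le_sum_of_le d r m k i hk hi h).trans ?_
      gcongr
      exact sum_hyp_mul_abs_le d r m hn hm
    -- Below the mode, exchanging the subset with its complement sends `i` to `m - i`, which lies
    -- beyond the mode of the reflected weights.
    · rw [hyp_symm d r hi]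
      have h' : ((r : ℝ) + 1) * (m + 1) / (r + d + 2) ≤ (m - i : ℕ) + 1 := by
        rw [Nat.cast_sub hi]
        have : ((r : ℝ) + 1) * (m + 1) / (r + d + 2)
            = m + 1 - (d + 1) * (m + 1) / (d + r + 2) := by
          field_simp; ring
        rw [this]
        push Not at h
        linarith
      refine (hyp_le_sum_of_le r d m k (m - i) (by lia) (by lia) h').trans ?_
      have e : ((r : ℝ) + d + 2) ^ 3 / ((r + 1) * (m + 1) * (d + 1) * (k + 1))
          = (d + r + 2) ^ 3 / ((d + 1) * (m + 1) * (r + 1) * (k + 1)) := by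
        congr 1 <;> ring
      rw [e]
      gcongr
      refine (sum_hyp_mul_abs_le r d m (by lia) (by lia)).trans ?_
      rw [add_comm r d, mul_comm ((r : ℝ) + 1), add_comm (r : ℝ) d]
  rw [div_le_iff₀ hT0]
  refine main.trans ?_
  rw [mul_left_comm, mul_comm]
  refine mul_le_mul_of_nonneg_right ?_ hT0.le
  set n2 : ℝ := (d : ℝ) + r + 2 with hn2
  set D : ℝ := (d : ℝ) + 1 with hD
  set R : ℝ := (r : ℝ) + 1 with hR
  have hD0 : 0 < D := by positivity
  have hR0 : 0 < R := by positivity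
  have hn0 : 0 < n2 := by positivity
  have hDR : n2 = D + R := by rw [hn2, hD, hR]; ring
  have s1 : √(3 * (D * R) / n2) = √3 * (√D * √R) / √n2 := by
    rw [Real.sqrt_div (by positivity), Real.sqrt_mul (by positivity), Real.sqrt_mul hD0.le]
  have h3 : √3 ≤ 2 := by
    rw [Real.sqrt_le_left (by norm_num)]; norm_num
  have h4 : √n2 ≤ √D + √R := by
    rw [Real.sqrt_le_left (by positivity), add_sq, Real.sq_sqrt hD0.le, Real.sq_sqrt hR0.le, hDR]
    have : 0 ≤ √D * √R := by positivity
    linarith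
  have h5 : n2 ^ 3 / (D * (m + 1) * R * (k + 1)) ≤ n2 / (c ^ 2 * (D * R)) := by
    rw [div_le_div_iff₀ (by positivity) (by positivity)]
    have : (c * n2) * (c * n2) ≤ ((m : ℝ) + 1) * (k + 1) := by gcongr
    calc n2 ^ 3 * (c ^ 2 * (D * R)) = n2 * (D * R) * ((c * n2) * (c * n2)) := by ring
      _ ≤ n2 * (D * R) * (((m : ℝ) + 1) * (k + 1)) := by gcongr
      _ = _ := by ring
  have hsD : 0 < √D := by positivity
  have hsR : 0 < √R := by positivity
  have hsn : 0 < √n2 := by positivity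
  have eD : D = √D * √D := (Real.mul_self_sqrt hD0.le).symm
  have eR : R = √R * √R := (Real.mul_self_sqrt hR0.le).symm
  have en : n2 = √n2 * √n2 := (Real.mul_self_sqrt hn0.le).symm
  calc n2 ^ 3 / (D * (m + 1) * R * (k + 1)) * √(3 * (D * R) / n2)
      ≤ n2 / (c ^ 2 * (D * R)) * (2 * (√D * √R) / √n2) := by
        rw [s1]; gcongr
    _ = 2 / c ^ 2 * (√n2 / (√D * √R)) := by
        generalize √D = a at *
        generalize √R = b at *
        generalize √n2 = e at *
        rw [en, eD, eR]; field_simp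
    _ ≤ 2 / c ^ 2 * ((√D + √R) / (√D * √R)) := by gcongr
    _ = _ := by
        congr 1
        field_simp
        ring

/-! ### Expected overlap of two paths -/

lemma sum_one_div_sqrt_le (n : ℕ) :
    ∑ j ∈ Finset.range n, 1 / √((j : ℝ) + 1) ≤ 2 * √n := by
  induction n with
  | zero => simp
  | succ n ih =>
    rw [Finset.sum_range_succ]
    have h0 : 0 ≤ √(n : ℝ) := Real.sqrt_nonneg _
    have h1 : 0 < √((n : ℝ) + 1) := by positivity
    have e0 : √(n : ℝ) * √(n : ℝ) = n := Real.mul_self_sqrt (by positivity)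
    have e1 : √((n : ℝ) + 1) * √((n : ℝ) + 1) = n + 1 := Real.mul_self_sqrt (by positivity)
    have : 1 / √((n : ℝ) + 1) ≤ 2 * (√((n : ℝ) + 1) - √(n : ℝ)) := by
      rw [div_le_iff₀ h1]
      nlinarith [sq_nonneg (√((n : ℝ) + 1) - √(n : ℝ))]
    push_cast
    linarith

/-- The expected overlap of two independent uniform lattice paths with `n` steps. -/
lemma sum_sum_hyp_sq_le (n m k : ℕ) (hk : n = m + k) (hn : 2 ≤ n)
    {c : ℝ} (hc : 0 < c) (hmc : c * (n + 2) ≤ m + 1) (hkc : c * (n + 2) ≤ k + 1) :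
    ∑ d ∈ Finset.range (n + 1), ∑ i ∈ Finset.range (m + 1),
      (hyp d (n - d) m i / n.choose m) ^ 2 ≤ 8 / c ^ 2 * √(n + 1) := by
  have hT0 : (0 : ℝ) < n.choose m := by exact_mod_cast Nat.choose_pos (by lia)
  -- On each antidiagonal the sum of squared probabilities is at most the largest probability, since
  -- they add up to one.
  have inner : ∀ d ∈ Finset.range (n + 1), ∑ i ∈ Finset.range (m + 1),
      (hyp d (n - d) m i / n.choose m) ^ 2 ≤
        2 / c ^ 2 * (1 / √(d + 1) + 1 / √((n - d : ℕ) + 1)) := by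
    intro d hd
    have hd' : d + (n - d) = n := by
      have := Finset.mem_range.1 hd
      lia
    have hs : ((d : ℝ) + (n - d : ℕ)) = n := by exact_mod_cast hd'
    set B := 2 / c ^ 2 * (1 / √((d : ℝ) + 1) + 1 / √(((n - d : ℕ) : ℝ) + 1))
    have hb : ∀ i ∈ Finset.range (m + 1), hyp d (n - d) m i / n.choose m ≤ B := by
      intro i hi
      have := hyp_div_le d (n - d) m k i (by lia) (by lia)
        (by have := Finset.mem_range.1 hi; lia) hc (by rwa [hs]) (by rwa [hs])
      rwa [hd'] at this
    calc ∑ i ∈ Finset.range (m + 1), (hyp d (n - d) m i / n.choose m) ^ 2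
        ≤ ∑ i ∈ Finset.range (m + 1), B * (hyp d (n - d) m i / n.choose m) := by
          refine Finset.sum_le_sum fun i hi => ?_
          rw [sq]
          exact mul_le_mul_of_nonneg_right (hb i hi)
            (div_nonneg (hyp_nonneg _ _ _ _) hT0.le)
      _ = B := by
          rw [← Finset.mul_sum, ← Finset.sum_div, sum_hyp, hd', div_self hT0.ne', mul_one]
  refine (Finset.sum_le_sum inner).trans ?_
  rw [← Finset.mul_sum, Finset.sum_add_distrib]
  have h1 := sum_one_div_sqrt_le (n + 1)
  have h2 : ∑ d ∈ Finset.range (n + 1), 1 / √(((n - d : ℕ) : ℝ) + 1)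
      = ∑ d ∈ Finset.range (n + 1), 1 / √((d : ℝ) + 1) := by
    rw [← Finset.sum_range_reflect]
    refine Finset.sum_congr rfl fun d hd => ?_
    have := Finset.mem_range.1 hd
    congr 4
    lia
  rw [h2]
  push_cast at h1
  calc 2 / c ^ 2 * _ ≤ 2 / c ^ 2 * (2 * √((n : ℝ) + 1) + 2 * √((n : ℝ) + 1)) := by gcongr
    _ = _ := by ring

/-! ### Lattice paths encoded by the times of their right steps -/

/-- The square on the `d`-th antidiagonal reached by `i` steps to the right. -/
def antidiagSquare (d i : ℕ) : ℕ+ × ℕ+ := (i.succPNat, (d - i).succPNat)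

/-- The bounds `i ≤ d` and `i' ≤ d'` matter: truncated subtraction would otherwise identify
different indices. -/
lemma antidiagSquare_inj {d i d' i' : ℕ} (hi : i ≤ d) (hi' : i' ≤ d')
    (h : antidiagSquare d i = antidiagSquare d' i') : d = d' ∧ i = i' := by
  simp only [antidiagSquare, Prod.mk.injEq, Nat.succPNat_inj] at h
  lia

/-- The square reached after `k` steps when the steps to the right take place at the times
in `A`. -/
def pathSquare (A : Finset ℕ) (k : ℕ) : ℕ+ × ℕ+ :=
  antidiagSquare k (A ∩ Finset.range k).card

/-- The path with `n` steps whose steps to the right take place at the times in `A`. -/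
def latticePath (n : ℕ) (A : Finset ℕ) : Finset (ℕ+ × ℕ+) :=
  (Finset.range (n + 1)).image (pathSquare A)

lemma card_inter_range_le (A : Finset ℕ) (k : ℕ) : (A ∩ Finset.range k).card ≤ k := by
  simpa using Finset.card_le_card (Finset.inter_subset_right (s₁ := A) (s₂ := Finset.range k))

lemma card_inter_range_succ (A : Finset ℕ) (k : ℕ) :
    (A ∩ Finset.range (k + 1)).card = (A ∩ Finset.range k).card + if k ∈ A then 1 else 0 := by
  rw [Finset.range_add_one]
  split_ifs with h
  · rw [Finset.inter_insert_of_mem h, Finset.card_insert_of_notMem (by simp)]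
  · rw [Finset.inter_insert_of_notMem h, add_zero]

lemma pathSquare_zero (A : Finset ℕ) : pathSquare A 0 = (1, 1) := by
  simp only [pathSquare, antidiagSquare, Finset.range_zero, Finset.inter_empty, Finset.card_empty]
  rfl

lemma pathSquare_eq_antidiagSquare_iff {A : Finset ℕ} {k d i : ℕ} (hi : i ≤ d) :
    pathSquare A k = antidiagSquare d i ↔ k = d ∧ (A ∩ Finset.range d).card = i := by
  constructor
  · intro h
    obtain ⟨rfl, h2⟩ := antidiagSquare_inj (card_inter_range_le A k) hi h
    exact ⟨rfl, h2⟩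
  · rintro ⟨rfl, rfl⟩
    rfl

lemma pathSquare_injective (A : Finset ℕ) : Function.Injective (pathSquare A) := fun _ l h =>
  ((pathSquare_eq_antidiagSquare_iff (card_inter_range_le A l)).1 h).1

lemma card_latticePath (n : ℕ) (A : Finset ℕ) : (latticePath n A).card = n + 1 := by
  rw [latticePath, Finset.card_image_of_injective _ (pathSquare_injective A), Finset.card_range]

lemma antidiagSquare_mem_latticePath {n d i : ℕ} {A : Finset ℕ} (hi : i ≤ d) :
    antidiagSquare d i ∈ latticePath n A ↔ d ≤ n ∧ (A ∩ Finset.range d).card = i := by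
  simp only [latticePath, Finset.mem_image, Finset.mem_range,
    pathSquare_eq_antidiagSquare_iff hi]
  constructor
  · rintro ⟨k, hk, rfl, h⟩
    exact ⟨by lia, h⟩
  · rintro ⟨h1, h2⟩
    exact ⟨d, by lia, rfl, h2⟩

lemma latticePath_injOn (n : ℕ) :
    Set.InjOn (latticePath n) {A | A ⊆ Finset.range n} := by
  intro A hA B hB h
  have key : ∀ k ≤ n, (A ∩ Finset.range k).card = (B ∩ Finset.range k).card := by
    intro k hk
    have : antidiagSquare k (A ∩ Finset.range k).card ∈ latticePath n B := by
      rw [← h, antidiagSquare_mem_latticePath (card_inter_range_le A k)]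
      exact ⟨hk, rfl⟩
    rw [antidiagSquare_mem_latticePath (card_inter_range_le A k)] at this
    exact this.2.symm
  have aux : ∀ k < n, (k ∈ A ↔ k ∈ B) := by
    intro k hk
    have h1 := key k hk.le
    have h2 := key (k + 1) hk
    rw [card_inter_range_succ, card_inter_range_succ, h1] at h2
    by_cases a : k ∈ A <;> by_cases b : k ∈ B <;> simp [a, b] at h2 ⊢
  ext k
  constructor
  · intro hk
    exact (aux k (Finset.mem_range.1 (hA hk))).1 hk
  · intro hk
    exact (aux k (Finset.mem_range.1 (hB hk))).2 hk

/-- The up-right paths are parametrized by the set of times of the steps to the right. -/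
lemma upRightPaths_eq_image (m k : ℕ) :
    upRightPaths (m + 1) (k + 1) =
      ((Finset.powersetCard m (Finset.range (m + k))).image (latticePath (m + k)) :
        Set (Finset (ℕ+ × ℕ+))) := by
  have e1 : m + 1 + (k + 1) - 2 = m + k := by lia
  have e2 : m + 1 + (k + 1) - 1 = m + k + 1 := by lia
  ext σ
  simp only [upRightPaths, Set.mem_ofPred_eq, IsUpRightPath, Set.mem_image, Finset.mem_coe,
    Finset.coe_image, Finset.mem_powersetCard, e1, e2]
  constructor
  · rintro ⟨c, h0, hM, hN, hstep, rfl⟩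
    set A := (Finset.range (m + k)).filter (fun j => (c (j + 1)).1 = (c j).1 + 1) with hA
    have key : ∀ j ≤ m + k, c j = pathSquare A j := by
      intro j
      induction j with
      | zero =>
        intro _
        rw [h0, pathSquare_zero]
      | succ j ih =>
        intro hj
        have ihj := ih (by lia)
        have hle := card_inter_range_le A j
        have hmem : j ∈ A ↔ (c (j + 1)).1 = (c j).1 + 1 := by
          rw [hA, Finset.mem_filter, Finset.mem_range]
          exact ⟨fun h => h.2, fun h => ⟨by lia, h⟩⟩
        unfold pathSquare at ihj ⊢
        rw [card_inter_range_succ]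
        rcases hstep j (by lia) with h | h
        · have : j ∈ A := by rw [hmem, h]
          rw [h, ihj, if_pos this]
          refine Prod.ext rfl ?_
          show (j - _).succPNat = _
          congr 1
          lia
        · have : j ∉ A := by
            rw [hmem, h]
            intro h'
            have := congrArg PNat.val h'
            simp at this
          rw [h, ihj, if_neg this]
          refine Prod.ext rfl ?_
          apply PNat.eq
          simp only [antidiagSquare, PNat.add_coe, Nat.succPNat_coe, PNat.one_coe]
          lia
    have hAs : A ⊆ Finset.range (m + k) := Finset.filter_subset _ _
    refine ⟨A, ⟨hAs, ?_⟩, ?_⟩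
    · rw [key _ le_rfl] at hM
      simp only [pathSquare, antidiagSquare, Nat.succPNat_coe,
        Finset.inter_eq_left.2 hAs] at hM
      lia
    · refine Finset.image_congr fun j hj => ?_
      exact (key j (by simpa [Nat.lt_succ_iff] using hj)).symm
  · rintro ⟨A, ⟨hAs, hAc⟩, rfl⟩
    refine ⟨pathSquare A, pathSquare_zero A, ?_, ?_, ?_, rfl⟩
    · simp [pathSquare, antidiagSquare, Finset.inter_eq_left.2 hAs, hAc]
    · simp [pathSquare, antidiagSquare, Finset.inter_eq_left.2 hAs, hAc]
    · intro j _
      have hle := card_inter_range_le A j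
      unfold pathSquare
      rw [card_inter_range_succ]
      by_cases h : j ∈ A
      · left
        rw [if_pos h]
        refine Prod.ext rfl ?_
        show Nat.succPNat _ = Nat.succPNat _
        congr 1
        lia
      · right
        rw [if_neg h]
        refine Prod.ext rfl ?_
        apply PNat.eq
        simp only [antidiagSquare, PNat.add_coe, Nat.succPNat_coe, PNat.one_coe]
        lia

/-- Number of `m`-subsets of `range n` with `i` elements below `d`. -/
lemma card_filter_inter_range_le {n m d i : ℕ} :
    (((Finset.powersetCard m (Finset.range n)).filter
      (fun A => (A ∩ Finset.range d).card = i)).card : ℝ) ≤ hyp d (n - d) m i := by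
  have : ((Finset.powersetCard m (Finset.range n)).filter
      (fun A => (A ∩ Finset.range d).card = i)).card ≤
      ((Finset.powersetCard i (Finset.range d)) ×ˢ
        (Finset.powersetCard (m - i) (Finset.Ico d n))).card := by
    refine Finset.card_le_card_of_injOn
      (fun A => (A ∩ Finset.range d, A \ Finset.range d)) ?_ ?_
    · intro A hA
      simp only [Finset.coe_filter, Finset.mem_powersetCard, Set.mem_ofPred_eq] at hA
      obtain ⟨⟨hs, hc⟩, hi⟩ := hA
      simp only [Finset.coe_product, Set.mem_prod, Finset.mem_coe, Finset.mem_powersetCard]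
      refine ⟨⟨Finset.inter_subset_right, hi⟩, ?_, ?_⟩
      · intro x hx
        have := Finset.mem_sdiff.1 hx
        have h2 := Finset.mem_range.1 (hs this.1)
        have h3 := this.2
        rw [Finset.mem_range] at h3
        rw [Finset.mem_Ico]
        lia
      · have := Finset.card_sdiff_add_card_inter A (Finset.range d)
        lia
    · intro A _ B _ h
      simp only [Prod.mk.injEq] at h
      rw [← Finset.sdiff_union_inter A (Finset.range d),
        ← Finset.sdiff_union_inter B (Finset.range d), h.1, h.2]
  rw [Finset.card_product, Finset.card_powersetCard, Finset.card_powersetCard,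
    Finset.card_range, Nat.card_Ico] at this
  unfold hyp
  exact_mod_cast this

/-! ### Visit probabilities and averages over paths -/

/-- The squares of the antidiagonals `0, ..., n` that can be reached with at most `m` steps to
the right. -/
def reachableSquares (n m : ℕ) : Finset (ℕ+ × ℕ+) :=
  (((Finset.range (n + 1)) ×ˢ (Finset.range (m + 1))).filter (fun x => x.2 ≤ x.1)).image
    (fun x => antidiagSquare x.1 x.2)

/-- The probability that a uniform lattice path with `n` steps, `m` of them to the right, visits
the square `a`. -/
noncomputable def visitProb (n m : ℕ) (a : ℕ+ × ℕ+) : ℝ :=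
  (((Finset.powersetCard m (Finset.range n)).filter (fun A => a ∈ latticePath n A)).card : ℝ)
    / n.choose m

lemma visitProb_nonneg (n m : ℕ) (a : ℕ+ × ℕ+) : 0 ≤ visitProb n m a := by
  unfold visitProb; positivity

lemma latticePath_subset_reachableSquares {n m : ℕ} {A : Finset ℕ}
    (hA : A ∈ Finset.powersetCard m (Finset.range n)) :
    latticePath n A ⊆ reachableSquares n m := by
  intro a ha
  obtain ⟨k, hk, rfl⟩ := Finset.mem_image.1 ha
  refine Finset.mem_image.2 ⟨(k, (A ∩ Finset.range k).card), ?_, rfl⟩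
  rw [Finset.mem_filter, Finset.mem_product]
  refine ⟨⟨hk, ?_⟩, card_inter_range_le A k⟩
  have := Finset.card_le_card (Finset.inter_subset_left (s₁ := A) (s₂ := Finset.range k))
  rw [(Finset.mem_powersetCard.1 hA).2] at this
  exact Finset.mem_range.2 (by lia)

/-- The left side is the expected number of squares shared by two independent uniform paths.
Reachable squares outside the rectangle have visit probability zero and do no harm. -/
lemma sum_visitProb_sq_le (n m k : ℕ) (hk : n = m + k) (hn : 2 ≤ n)
    {c : ℝ} (hc : 0 < c) (hmc : c * (n + 2) ≤ m + 1) (hkc : c * (n + 2) ≤ k + 1) :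
    ∑ a ∈ reachableSquares n m, visitProb n m a ^ 2 ≤ 8 / c ^ 2 * √(n + 1) := by
  refine le_trans ?_ (sum_sum_hyp_sq_le n m k hk hn hc hmc hkc)
  rw [reachableSquares, Finset.sum_image, ← Finset.sum_product']
  · refine le_trans (Finset.sum_le_sum fun x hx => ?_)
      (Finset.sum_le_sum_of_subset_of_nonneg (Finset.filter_subset _ _)
        fun _ _ _ => sq_nonneg _)
    simp only [Finset.mem_filter] at hx
    refine pow_le_pow_left₀ (visitProb_nonneg _ _ _) ?_ 2
    refine div_le_div_of_nonneg_right (le_trans ?_ card_filter_inter_range_le) (Nat.cast_nonneg _)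
    refine Nat.cast_le.2 (Finset.card_le_card (Finset.monotone_filter_right _ fun A hA h => ?_))
    exact ((antidiagSquare_mem_latticePath hx.2).1 h).2
  · rintro ⟨d, i⟩ hx ⟨d', i'⟩ hx' h
    simp only [Finset.coe_filter, Set.mem_ofPred_eq] at hx hx'
    obtain ⟨rfl, rfl⟩ := antidiagSquare_inj hx.2 hx'.2 h
    rfl

/-- Averaging the total of `v` along a uniform path. -/
lemma sum_sum_latticePath (n m : ℕ) (v : ℕ+ × ℕ+ → ℝ) :
    (∑ A ∈ Finset.powersetCard m (Finset.range n), ∑ a ∈ latticePath n A, v a) / n.choose m =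
      ∑ a ∈ reachableSquares n m, visitProb n m a * v a := by
  have : ∀ A ∈ Finset.powersetCard m (Finset.range n), ∑ a ∈ latticePath n A, v a =
      ∑ a ∈ reachableSquares n m, if a ∈ latticePath n A then v a else 0 := by
    intro A hA
    rw [← Finset.sum_filter, Finset.filter_mem_eq_inter,
      Finset.inter_eq_right.2 (latticePath_subset_reachableSquares hA)]
  rw [Finset.sum_congr rfl this, Finset.sum_comm, Finset.sum_div]
  refine Finset.sum_congr rfl fun a _ => ?_
  rw [← Finset.sum_filter, Finset.sum_const, nsmul_eq_mul, visitProb]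
  ring

/-- The average of `F` over the uniform lattice path with `n` steps, `m` of them to the right. -/
noncomputable def pathAverage (n m : ℕ) (F : Finset (ℕ+ × ℕ+) → ℝ) : ℝ :=
  (∑ A ∈ Finset.powersetCard m (Finset.range n), F (latticePath n A)) / n.choose m

/-- The prescribed masses of the individual paths add up to one, so `σ` is almost surely a path;
injectivity of `latticePath` turns the average over paths into one over subsets. -/
lemma IsUniformUpRightPath.integral_eq {m k : ℕ} {Ω : Type*} [MeasurableSpace Ω] {P : Measure Ω}
    [IsProbabilityMeasure P] {σ : Ω → Finset (ℕ+ × ℕ+)}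
    (hmeas : ∀ π, MeasurableSet {s | σ s = π})
    (h : IsUniformUpRightPath (m + 1) (k + 1) P σ) (F : Finset (ℕ+ × ℕ+) → ℝ) :
    ∫ s, F (σ s) ∂P = pathAverage (m + k) m F := by
  set S := (Finset.powersetCard m (Finset.range (m + k))).image (latticePath (m + k)) with hS
  have hinj : Set.InjOn (latticePath (m + k))
      (Finset.powersetCard m (Finset.range (m + k)) : Set (Finset ℕ)) :=
    (latticePath_injOn (m + k)).mono fun A hA => (Finset.mem_powersetCard.1 hA).1
  have hcard : S.card = (m + k).choose m := by
    rw [hS, Finset.card_image_of_injOn hinj, Finset.card_powersetCard, Finset.card_range]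
  have hpos : 0 < (m + k).choose m := Nat.choose_pos (by lia)
  unfold IsUniformUpRightPath at h
  rw [upRightPaths_eq_image, ← hS, Set.ncard_coe_finset, hcard] at h
  have hdisj : Set.PairwiseDisjoint (S : Set (Finset (ℕ+ × ℕ+))) (fun π => {s | σ s = π}) := by
    intro π _ π' _ hne
    refine Set.disjoint_left.2 fun s hs hs' => hne ?_
    simp only [Set.mem_ofPred_eq] at hs hs'
    exact hs.symm.trans hs'
  have htot : P (⋃ π ∈ S, {s | σ s = π}) = 1 := by
    rw [measure_biUnion_finset hdisj fun π _ => hmeas π,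
      Finset.sum_congr rfl fun π hπ => h π hπ, Finset.sum_const, hcard, nsmul_eq_mul,
      ENNReal.mul_inv_cancel (by exact_mod_cast hpos.ne') (ENNReal.natCast_ne_top _)]
  have hae : ∀ᵐ s ∂P, s ∈ ⋃ π ∈ S, {s | σ s = π} :=
    mem_ae_iff_prob_eq_one (Finset.measurableSet_biUnion S fun π _ => hmeas π) |>.2 htot
  have heq : (fun s => F (σ s)) =ᵐ[P]
      fun s => ∑ π ∈ S, Set.indicator {s | σ s = π} (fun _ => F π) s := by
    filter_upwards [hae] with s hs
    simp only [Set.mem_iUnion, Set.mem_ofPred_eq, exists_prop, exists_eq_right'] at hs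
    rw [Finset.sum_eq_single_of_mem (σ s) hs]
    · simp
    · intro π _ hne
      exact Set.indicator_of_notMem (fun h' => hne h'.symm) _
  rw [integral_congr_ae heq, integral_finsetSum]
  · have : ∀ π ∈ S, ∫ s, Set.indicator {s | σ s = π} (fun _ => F π) s ∂P =
        F π / (m + k).choose m := by
      intro π hπ
      rw [integral_indicator_const _ (hmeas π), measureReal_def, h π hπ]
      simp [div_eq_inv_mul]
    rw [Finset.sum_congr rfl this, ← Finset.sum_div, hS, Finset.sum_image hinj, pathAverage]
  · intro π _
    exact (integrable_const _).indicator (hmeas π)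

/-! ### Sixth-moment concentration -/

/-- The term linear in `D` is kept exactly, so that it integrates to zero for centered `D`. The
higher mixed terms are split by AM–GM: 10, 3 and 14 times the squares `e1`, `e2`, `e3` give 39 and
18. -/
lemma add_pow_six_le (h D : ℝ) :
    (h + D) ^ 6 ≤ h ^ 6 + 6 * h ^ 5 * D + 39 * (h ^ 4 * D ^ 2) + 18 * D ^ 6 := by
  have e1 : 0 ≤ h ^ 2 * D ^ 2 * (h - D) ^ 2 := by positivity
  have e2 : 0 ≤ D ^ 4 * (h - D) ^ 2 := by positivity
  have e3 : 0 ≤ D ^ 2 * (h ^ 2 - D ^ 2) ^ 2 := by positivity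
  nlinarith

lemma integrable_of_abs_le {Ω : Type*} [MeasurableSpace Ω] {P : Measure Ω} [IsProbabilityMeasure P]
    {f : Ω → ℝ} (hf : Measurable f) (B : ℝ) (hB : ∀ x, |f x| ≤ B) : Integrable f P :=
  Integrable.of_bound hf.aestronglyMeasurable B (ae_of_all _ hB)

/-- The one-coordinate step: if `D` is centered and controlled by `c (|y| + 1)` then adding it to
a constant increases the sixth moment only in second order. -/
lemma integral_add_pow_six_le {μ : Measure ℝ} [IsProbabilityMeasure μ] {κ c : ℝ} (hκ : 1 ≤ κ)
    (hi2 : Integrable (fun y => y ^ 2) μ) (h2 : ∫ y, y ^ 2 ∂μ ≤ 1)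
    (hi6 : Integrable (fun y => y ^ 6) μ) (h6 : ∫ y, y ^ 6 ∂μ ≤ κ)
    {D : ℝ → ℝ} (hDm : Measurable D) (B : ℝ) (hDB : ∀ y, |D y| ≤ B)
    (hD0 : ∫ y, D y ∂μ = 0) (hD : ∀ y, |D y| ≤ c * (|y| + 1)) (h : ℝ) :
    ∫ y, (h + D y) ^ 6 ∂μ ≤ h ^ 6 + 39 * (4 * κ * c ^ 2) * h ^ 4 + 18 * (4 * κ * c ^ 2) ^ 3 := by
  have hB0 : 0 ≤ B := (abs_nonneg _).trans (hDB 0)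
  have iD : Integrable D μ := integrable_of_abs_le hDm B hDB
  have iDp : ∀ k : ℕ, Integrable (fun y => D y ^ k) μ := fun k =>
    integrable_of_abs_le (hDm.pow_const k) (B ^ k)
      (fun y => by rw [abs_pow]; exact pow_le_pow_left₀ (abs_nonneg _) (hDB y) k)
  have bD2 : ∫ y, D y ^ 2 ∂μ ≤ 4 * κ * c ^ 2 := by
    have : ∫ y, D y ^ 2 ∂μ ≤ ∫ y, 2 * c ^ 2 * (y ^ 2 + 1) ∂μ := by
      refine integral_mono (iDp 2) ((hi2.add (integrable_const 1)).const_mul _) fun y => ?_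
      have h1 : |D y| ^ 2 ≤ (c * (|y| + 1)) ^ 2 := pow_le_pow_left₀ (abs_nonneg _) (hD y) 2
      rw [sq_abs, mul_pow] at h1
      have h3 : (|y| + 1) ^ 2 ≤ 2 * (y ^ 2 + 1) := by
        rw [← sq_abs y]; nlinarith [sq_nonneg (|y| - 1)]
      have h4 : c ^ 2 * (|y| + 1) ^ 2 ≤ c ^ 2 * (2 * (y ^ 2 + 1)) := by gcongr
      simp only
      linarith
    rw [integral_const_mul, integral_add hi2 (integrable_const 1)] at this
    simp only [integral_const, probReal_univ, smul_eq_mul, mul_one] at this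
    have h5 : 2 * c ^ 2 * (∫ y, y ^ 2 ∂μ + 1) ≤ 2 * c ^ 2 * (κ + κ) := by gcongr; linarith
    linarith
  -- Written as the cube of the second-moment bound, at the price of `κ ≤ κ ^ 3`, so that one
  -- parameter controls both moments.
  have bD6 : ∫ y, D y ^ 6 ∂μ ≤ (4 * κ * c ^ 2) ^ 3 := by
    have : ∫ y, D y ^ 6 ∂μ ≤ ∫ y, 32 * c ^ 6 * (y ^ 6 + 1) ∂μ := by
      refine integral_mono (iDp 6) ((hi6.add (integrable_const 1)).const_mul _) fun y => ?_
      have h1 : |D y| ^ 6 ≤ (c * (|y| + 1)) ^ 6 := pow_le_pow_left₀ (abs_nonneg _) (hD y) 6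
      have e6 : ∀ z : ℝ, |z| ^ 6 = z ^ 6 := fun z => Even.pow_abs (by decide) z
      rw [e6, mul_pow] at h1
      have h3 : (|y| + 1) ^ 6 ≤ 32 * (y ^ 6 + 1) := by
        have := add_pow_le (abs_nonneg y) zero_le_one 6
        rw [e6] at this
        norm_num at this
        exact this
      have h4 : c ^ 6 * (|y| + 1) ^ 6 ≤ c ^ 6 * (32 * (y ^ 6 + 1)) := by gcongr
      simp only
      linarith
    rw [integral_const_mul, integral_add hi6 (integrable_const 1)] at this
    simp only [integral_const, probReal_univ, smul_eq_mul, mul_one] at this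
    have h5 : 32 * c ^ 6 * (∫ y, y ^ 6 ∂μ + 1) ≤ 32 * c ^ 6 * (κ ^ 3 + κ ^ 3) := by
      have hk : κ ≤ κ ^ 3 := le_self_pow₀ hκ (by norm_num)
      gcongr
      · linarith
      · linarith
    linarith [(by ring : 32 * c ^ 6 * (κ ^ 3 + κ ^ 3) = (4 * κ * c ^ 2) ^ 3)]
  have ihD : Integrable (fun y => (h + D y) ^ 6) μ := by
    refine integrable_of_abs_le ((hDm.const_add h).pow_const 6) ((|h| + B) ^ 6) fun y => ?_
    rw [abs_pow]
    exact pow_le_pow_left₀ (abs_nonneg _) ((abs_add_le _ _).trans (by linarith [hDB y])) 6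
  have i1 : Integrable (fun y => h ^ 6 + 6 * h ^ 5 * D y) μ :=
    (integrable_const _).add (iD.const_mul _)
  have i2 : Integrable (fun y => 39 * (h ^ 4 * D y ^ 2)) μ := ((iDp 2).const_mul _).const_mul _
  have i3 : Integrable (fun y => 18 * D y ^ 6) μ := (iDp 6).const_mul _
  have i12 : Integrable (fun y => h ^ 6 + 6 * h ^ 5 * D y + 39 * (h ^ 4 * D y ^ 2)) μ := i1.add i2
  calc ∫ y, (h + D y) ^ 6 ∂μ
      ≤ ∫ y, (h ^ 6 + 6 * h ^ 5 * D y + 39 * (h ^ 4 * D y ^ 2) + 18 * D y ^ 6) ∂μ :=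
        integral_mono ihD (i12.add i3) fun y => add_pow_six_le h (D y)
    _ = h ^ 6 + 39 * (h ^ 4 * ∫ y, D y ^ 2 ∂μ) + 18 * ∫ y, D y ^ 6 ∂μ := by
        rw [integral_add i12 i3, integral_add i1 i2,
          integral_add (integrable_const _) (iD.const_mul _)]
        simp only [integral_const_mul, hD0, integral_const, probReal_univ, smul_eq_mul, one_mul,
          mul_zero, add_zero]
    _ ≤ h ^ 6 + 39 * (h ^ 4 * (4 * κ * c ^ 2)) + 18 * (4 * κ * c ^ 2) ^ 3 := by
        have : 0 ≤ h ^ 4 := by positivity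
        gcongr
    _ = _ := by ring

/-- Sixth-moment concentration for Lipschitz functions of independent random variables. -/
theorem integral_sub_integral_pow_six_le {ι Ω : Type*} [MeasurableSpace Ω] {P : Measure Ω}
    [IsProbabilityMeasure P] {w : ι → Ω → ℝ} (hw : ∀ i, Measurable (w i)) (hind : iIndepFun w P)
    {κ : ℝ} (hκ : 1 ≤ κ)
    (hi2 : ∀ i, Integrable (fun ω => w i ω ^ 2) P) (h2 : ∀ i, ∫ ω, w i ω ^ 2 ∂P ≤ 1)
    (hi6 : ∀ i, Integrable (fun ω => w i ω ^ 6) P) (h6 : ∀ i, ∫ ω, w i ω ^ 6 ∂P ≤ κ)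
    {ε : ℝ} (hε : 0 < ε) {c : ι → ℝ} (hc : ∀ i, 0 ≤ c i) (s : Finset ι) :
    ∀ (f : (ι → ℝ) → ℝ) (_ : Measurable f) (B : ℝ) (_ : ∀ x, |f x| ≤ B)
      (_ : ∀ x y, |f x - f y| ≤ ∑ i ∈ s, c i * |x i - y i|),
      ∫ ω, (f (fun i => w i ω) - ∫ ω', f (fun i => w i ω') ∂P) ^ 6 ∂P ≤
        (ε + 52 * κ * ∑ i ∈ s, c i ^ 2) ^ 3 := by
  classical
  -- Integrate out one coordinate at a time. Given the others, `f` is its conditional mean `g` plus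
  -- a centered increment; `g` inherits the Lipschitz bound on the remaining coordinates.
  induction s using Finset.induction_on with
  | empty =>
    intro f hf B hB hL
    have : ∀ x, f x = f 0 := fun x => by
      have := hL x 0
      simp only [Finset.sum_empty] at this
      exact sub_eq_zero.1 (abs_nonpos_iff.1 this)
    simp only [this _]
    simp
    positivity
  | insert a s ha ih =>
    intro f hf B hB hL
    have hB0 : 0 ≤ B := (abs_nonneg _).trans (hB 0)
    set μ := P.map (w a) with hμ
    have : IsProbabilityMeasure μ := Measure.isProbabilityMeasure_map (hw a).aemeasurable
    set X : Ω → ι → ℝ := fun ω i => if i ∈ s then w i ω else 0 with hX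
    have hXm : Measurable X := measurable_pi_lambda _ fun i => by
      simp only [hX]
      split_ifs
      · exact hw i
      · exact measurable_const
    set ν := P.map X with hν
    have : IsProbabilityMeasure ν := Measure.isProbabilityMeasure_map hXm.aemeasurable
    have hXY : IndepFun X (w a) P := by
      have h1 := hind.indepFun_finset s {a} (by simpa using ha) hw
      let φ : (s → ℝ) → ι → ℝ := fun z i => if h : i ∈ s then z ⟨i, h⟩ else 0
      let ψ : (({a} : Finset ι) → ℝ) → ℝ := fun z => z ⟨a, by simp⟩
      have hφ : Measurable φ := measurable_pi_lambda _ fun i => by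
        simp only [φ]
        split_ifs
        · exact measurable_pi_apply _
        · exact measurable_const
      have hψ : Measurable ψ := measurable_pi_apply _
      have h2 := h1.comp hφ hψ
      convert h2 using 1
      · funext ω i
        simp only [hX, φ, Function.comp]
        split_ifs <;> rfl
      · rfl
    have hmap : P.map (fun ω => (X ω, w a ω)) = ν.prod μ :=
      (indepFun_iff_map_prod_eq_prod_map_map hXm.aemeasurable (hw a).aemeasurable).1 hXY
    -- moments of the last coordinate
    have mi2 : Integrable (fun y : ℝ => y ^ 2) μ :=
      (integrable_map_measure (by fun_prop) (hw a).aemeasurable).2 (hi2 a)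
    have mi6 : Integrable (fun y : ℝ => y ^ 6) μ :=
      (integrable_map_measure (by fun_prop) (hw a).aemeasurable).2 (hi6 a)
    have m2 : ∫ y, y ^ 2 ∂μ ≤ 1 := by
      rw [hμ, integral_map (hw a).aemeasurable (by fun_prop)]; exact h2 a
    have m6 : ∫ y, y ^ 6 ∂μ ≤ κ := by
      rw [hμ, integral_map (hw a).aemeasurable (by fun_prop)]; exact h6 a
    have mi1 : Integrable (fun y : ℝ => |y|) μ := by
      refine (mi2.add (integrable_const 1)).mono' (by fun_prop) (ae_of_all _ fun y => ?_)
      simp only [Real.norm_eq_abs, abs_abs, Pi.add_apply]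
      rw [← sq_abs]
      nlinarith [sq_nonneg (|y| - 1), abs_nonneg y]
    have m1 : ∫ y, |y| ∂μ ≤ 1 := by
      have : ∫ y, |y| ∂μ ≤ ∫ y, (y ^ 2 + 1) / 2 ∂μ := by
        refine integral_mono mi1 ((mi2.add (integrable_const 1)).div_const 2) fun y => ?_
        simp only
        rw [← sq_abs]
        nlinarith [sq_nonneg (|y| - 1)]
      rw [integral_div, integral_add mi2 (integrable_const 1)] at this
      simp only [integral_const, probReal_univ, smul_eq_mul, mul_one] at this
      linarith
    -- averaging over the last coordinate
    set F : (ι → ℝ) × ℝ → ℝ := fun p => f (Function.update p.1 a p.2) with hF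
    have hFm : Measurable F := hf.comp measurable_update'
    have hFm2 : ∀ x, Measurable fun y => f (Function.update x a y) := fun x =>
      hf.comp (measurable_update x)
    have hFi : ∀ x, Integrable (fun y => f (Function.update x a y)) μ := fun x =>
      integrable_of_abs_le (hFm2 x) B fun y => hB _
    set g : (ι → ℝ) → ℝ := fun x => ∫ y, f (Function.update x a y) ∂μ with hg
    have hgm : Measurable g :=
      (hFm.stronglyMeasurable.integral_prod_right' (ν := μ)).measurable
    have hgB : ∀ x, |g x| ≤ B := fun x => by
      have := norm_integral_le_of_norm_le_const (μ := μ) (f := fun y => f (Function.update x a y))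
        (C := B) (ae_of_all _ fun y => hB _)
      simpa using this
    have hgL : ∀ x y, |g x - g y| ≤ ∑ i ∈ s, c i * |x i - y i| := fun x y => by
      rw [hg, ← integral_sub (hFi x) (hFi y)]
      have := norm_integral_le_of_norm_le_const (μ := μ)
        (f := fun z => f (Function.update x a z) - f (Function.update y a z))
        (C := ∑ i ∈ s, c i * |x i - y i|) (ae_of_all _ fun z => ?_)
      · simpa using this
      · refine (hL _ _).trans (le_of_eq ?_)
        rw [Finset.sum_insert ha]
        simp only [Function.update_self, sub_self, abs_zero, mul_zero, zero_add]
        refine Finset.sum_congr rfl fun i hi => ?_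
        have : i ≠ a := fun h => ha (h ▸ hi)
        simp [Function.update_of_ne this]
    -- The Lipschitz bound makes `f` depend only on the coordinates in `insert a s`, so setting the
    -- others to zero changes nothing.
    have hfX : ∀ ω, f (fun i => w i ω) = F (X ω, w a ω) := fun ω => by
      have := hL (fun i => w i ω) (Function.update (X ω) a (w a ω))
      rw [Finset.sum_eq_zero] at this
      · exact sub_eq_zero.1 (abs_nonpos_iff.1 this)
      · intro i hi
        by_cases h : i = a
        · subst h; simp
        · have : i ∈ s := (Finset.mem_insert.1 hi).resolve_left h
          simp [Function.update_of_ne h, hX, this]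
    have hgX : ∀ ω, g (fun i => w i ω) = g (X ω) := fun ω => by
      have := hgL (fun i => w i ω) (X ω)
      rw [Finset.sum_eq_zero] at this
      · exact sub_eq_zero.1 (abs_nonpos_iff.1 this)
      · intro i hi
        simp [hX, hi]
    have hprod : ∀ (G : (ι → ℝ) × ℝ → ℝ) (_ : Measurable G) (C : ℝ) (_ : ∀ p, |G p| ≤ C),
        ∫ ω, G (X ω, w a ω) ∂P = ∫ x, ∫ y, G (x, y) ∂μ ∂ν := fun G hG C hC => by
      rw [← integral_prod _ (integrable_of_abs_le hG C hC), ← hmap,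
        integral_map (hXm.prodMk (hw a)).aemeasurable hG.aestronglyMeasurable]
    have hmean : ∫ ω, f (fun i => w i ω) ∂P = ∫ ω, g (fun i => w i ω) ∂P := by
      simp only [hfX, hgX]
      rw [hprod F hFm B fun p => hB _, hν, integral_map hXm.aemeasurable hgm.aestronglyMeasurable]
    set m := ∫ ω, f (fun i => w i ω) ∂P with hm
    have hmB : |m| ≤ B := by
      have := norm_integral_le_of_norm_le_const (μ := P) (f := fun ω => f (fun i => w i ω))
        (C := B) (ae_of_all _ fun y => hB _)
      simpa using this
    have hih := ih g hgm B hgB hgL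
    rw [← hmean] at hih
    set T := ε + 52 * κ * ∑ i ∈ s, c i ^ 2 with hT
    have hS0 : 0 ≤ ∑ i ∈ s, c i ^ 2 := Finset.sum_nonneg fun i _ => sq_nonneg _
    have hT0 : 0 < T := by positivity
    have hgi : ∫ ω, (g (fun i => w i ω) - m) ^ 6 ∂P = ∫ x, (g x - m) ^ 6 ∂ν := by
      simp only [hgX]
      rw [hν, integral_map hXm.aemeasurable
        ((hgm.sub_const m).pow_const 6).aestronglyMeasurable]
    rw [hgi] at hih
    simp only [hfX]
    have hpowB : ∀ (k : ℕ) {z : ℝ}, |z| ≤ B → |(z - m) ^ k| ≤ (2 * B) ^ k := fun k z hz => by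
      rw [abs_pow]
      exact pow_le_pow_left₀ (abs_nonneg _) ((abs_sub _ _).trans (by linarith)) k
    rw [hprod (fun p => (F p - m) ^ 6) ((hFm.sub_const m).pow_const 6) ((2 * B) ^ 6)
      fun p => hpowB 6 (hB _)]
    set b := 4 * κ * c a ^ 2 with hb
    have hb0 : 0 ≤ b := by positivity
    have inner : ∀ x, ∫ y, (F (x, y) - m) ^ 6 ∂μ ≤
        (g x - m) ^ 6 + 39 * b * (g x - m) ^ 4 + 18 * b ^ 3 := fun x => by
      have e : ∀ y, F (x, y) - m = (g x - m) + (f (Function.update x a y) - g x) := fun y => by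
        simp only [hF]; ring
      simp only [e]
      refine integral_add_pow_six_le hκ mi2 m2 mi6 m6 ((hFm2 x).sub_const _) (2 * B)
        (fun y => (abs_sub _ _).trans (by linarith [hB (Function.update x a y), hgB x])) ?_ ?_ _
      · rw [integral_sub (hFi x) (integrable_const _)]
        simp [hg]
      · intro y
        have e2 : f (Function.update x a y) - g x =
            ∫ z, (f (Function.update x a y) - f (Function.update x a z)) ∂μ := by
          rw [integral_sub (integrable_const _) (hFi x)]
          simp [hg]
        rw [e2]
        have hLz : ∀ z, |f (Function.update x a y) - f (Function.update x a z)| ≤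
            c a * (|y| + |z|) := fun z => by
          refine (hL _ _).trans ?_
          rw [Finset.sum_insert ha, Finset.sum_eq_zero, add_zero]
          · simp only [Function.update_self]
            exact mul_le_mul_of_nonneg_left (abs_sub _ _) (hc a)
          · intro i hi
            have : i ≠ a := fun h => ha (h ▸ hi)
            simp [Function.update_of_ne this]
        have := norm_integral_le_of_norm_le (μ := μ)
          (f := fun z => f (Function.update x a y) - f (Function.update x a z))
          (g := fun z => c a * (|y| + |z|)) (((integrable_const _).add mi1).const_mul _)
          (ae_of_all _ hLz)
        rw [integral_const_mul, integral_add (integrable_const _) mi1] at this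
        simp only [integral_const, probReal_univ, smul_eq_mul, one_mul, Real.norm_eq_abs] at this
        exact this.trans (mul_le_mul_of_nonneg_left (by linarith) (hc a))
    have ig : ∀ k : ℕ, Integrable (fun x => (g x - m) ^ k) ν := fun k =>
      integrable_of_abs_le ((hgm.sub_const m).pow_const k) ((2 * B) ^ k)
        fun x => hpowB k (hgB x)
    have iF : Integrable (fun x => ∫ y, (F (x, y) - m) ^ 6 ∂μ) ν :=
      (integrable_of_abs_le ((hFm.sub_const m).pow_const 6) ((2 * B) ^ 6)
        (fun p => hpowB 6 (hB _)) : Integrable (fun p => (F p - m) ^ 6) (ν.prod μ)).integral_prod_left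
    -- With `z = (g x - m) ^ 2`, this integrates `3 T z² ≤ 2 z³ + T³`. Dividing by `T` is where `ε >
    -- 0` is needed.
    have h4 : ∫ x, (g x - m) ^ 4 ∂ν ≤ T ^ 2 := by
      have h : ∫ x, 3 * T * (g x - m) ^ 4 ∂ν ≤ ∫ x, (2 * (g x - m) ^ 6 + T ^ 3) ∂ν := by
        refine integral_mono ((ig 4).const_mul _)
          (((ig 6).const_mul _).add (integrable_const _)) fun x => ?_
        simp only
        nlinarith [mul_nonneg (by positivity : 0 ≤ 2 * (g x - m) ^ 2 + T)
          (sq_nonneg ((g x - m) ^ 2 - T))]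
      rw [integral_const_mul, integral_add ((ig 6).const_mul _) (integrable_const _),
        integral_const_mul] at h
      simp only [integral_const, probReal_univ, smul_eq_mul, one_mul] at h
      refine le_of_mul_le_mul_left ?_ (by positivity : 0 < 3 * T)
      linarith [(by ring : 3 * T * T ^ 2 = 3 * T ^ 3)]
    have ig46 : Integrable (fun x => (g x - m) ^ 6 + 39 * b * (g x - m) ^ 4) ν :=
      (ig 6).add ((ig 4).const_mul _)
    calc ∫ x, ∫ y, (F (x, y) - m) ^ 6 ∂μ ∂ν
        ≤ ∫ x, ((g x - m) ^ 6 + 39 * b * (g x - m) ^ 4 + 18 * b ^ 3) ∂ν :=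
          integral_mono iF (ig46.add (integrable_const _)) inner
      _ = ∫ x, (g x - m) ^ 6 ∂ν + 39 * b * ∫ x, (g x - m) ^ 4 ∂ν + 18 * b ^ 3 := by
          rw [integral_add ig46 (integrable_const _),
            integral_add (ig 6) ((ig 4).const_mul _), integral_const_mul]
          simp
      _ ≤ T ^ 3 + 39 * b * T ^ 2 + 18 * b ^ 3 := by gcongr
      -- Since 39 = 3 · 13, the cube matches the first two terms exactly; with `b = 4 κ c a ^ 2`
      -- this yields 52 = 13 · 4.
      _ ≤ (T + 13 * b) ^ 3 := by
          have : 0 ≤ T * b ^ 2 := by positivity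
          have : 0 ≤ b ^ 3 := by positivity
          linarith [(by ring : (T + 13 * b) ^ 3
            = T ^ 3 + 39 * b * T ^ 2 + 507 * (T * b ^ 2) + 2197 * b ^ 3)]
      _ = _ := by
          rw [Finset.sum_insert ha, hT, hb]
          ring

/-! ### Central limit theorem along varying finite families -/

lemma norm_exp_mul_I_sub_le (x : ℝ) :
    ‖Complex.exp (x * Complex.I) - (1 + x * Complex.I - (x : ℂ) ^ 2 / 2)‖ ≤ 4 * |x| ^ 3 := by
  have hn : ‖(x : ℂ) * Complex.I‖ = |x| := by simp
  rcases le_or_gt |x| 1 with hx | hx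
  · have h := Complex.norm_exp_sub_sum_le_norm_mul_exp ((x : ℂ) * Complex.I) 3
    rw [hn] at h
    have e : ∑ m ∈ Finset.range 3, ((x : ℂ) * Complex.I) ^ m / (m.factorial : ℂ) =
        1 + x * Complex.I - (x : ℂ) ^ 2 / 2 := by
      simp [Finset.sum_range_succ, Nat.factorial, mul_pow]
      ring
    rw [e] at h
    refine h.trans ?_
    rw [mul_comm]
    gcongr
    exact (Real.exp_le_exp.2 hx).trans (by linarith [Real.exp_one_lt_d9])
  · have h1 : ‖Complex.exp (x * Complex.I)‖ = 1 := Complex.norm_exp_ofReal_mul_I x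
    have h2 : ‖(x : ℂ) ^ 2 / 2‖ = |x| ^ 2 / 2 := by simp
    calc _ ≤ ‖Complex.exp (x * Complex.I)‖ + (‖(1 : ℂ)‖ + ‖(x : ℂ) * Complex.I‖ + ‖(x : ℂ) ^ 2 / 2‖) :=
          (norm_sub_le _ _).trans
            (add_le_add_right ((norm_sub_le _ _).trans (add_le_add_left (norm_add_le _ _) _)) _)
      _ = 1 + (1 + |x| + |x| ^ 2 / 2) := by rw [h1, h2, hn, norm_one]
      _ ≤ 4 * |x| ^ 3 := by
          have a2 : |x| ≤ |x| ^ 3 := le_self_pow₀ hx.le (by norm_num)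
          have a3 : |x| ^ 2 ≤ |x| ^ 3 := pow_le_pow_right₀ hx.le (by norm_num)
          linarith

/-- The error depends on the law only through `κ`, by `|y|³ ≤ 1 + y⁶`. This uniformity permits
families of summands that change arbitrarily with `n`. -/
lemma norm_charFun_sub_le {μ : Measure ℝ} [IsProbabilityMeasure μ] {κ : ℝ}
    (hi2 : Integrable (fun y => y ^ 2) μ) (h1 : ∫ y, y ∂μ = 0) (h2 : ∫ y, y ^ 2 ∂μ = 1)
    (hi6 : Integrable (fun y => y ^ 6) μ) (h6 : ∫ y, y ^ 6 ∂μ ≤ κ) (u : ℝ) :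
    ‖charFun μ u - (1 - (u : ℂ) ^ 2 / 2)‖ ≤ 4 * (1 + κ) * |u| ^ 3 := by
  have hi1 : Integrable (fun y : ℝ => y) μ := by
    refine (hi2.add (integrable_const 1)).mono' (by fun_prop) (ae_of_all _ fun y => ?_)
    simp only [Real.norm_eq_abs, Pi.add_apply]
    rw [← sq_abs]
    nlinarith [sq_nonneg (|y| - 1), abs_nonneg y]
  have c1 : Integrable (fun y : ℝ => (y : ℂ)) μ := hi1.ofReal
  have c2 : Integrable (fun y : ℝ => (y : ℂ) ^ 2) μ := by
    have := hi2.ofReal (𝕜 := ℂ)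
    simpa using this
  have ie : Integrable (fun y : ℝ => Complex.exp (u * y * Complex.I)) μ := by
    refine Integrable.of_bound (by fun_prop) 1 (ae_of_all _ fun y => ?_)
    rw [← Complex.ofReal_mul, Complex.norm_exp_ofReal_mul_I]
  have v1 : ∫ y : ℝ, (y : ℂ) ∂μ = 0 := by rw [integral_complex_ofReal, h1]; simp
  have v2 : ∫ y : ℝ, (y : ℂ) ^ 2 ∂μ = 1 := by
    have : ∫ y : ℝ, ((y ^ 2 : ℝ) : ℂ) ∂μ = 1 := by rw [integral_complex_ofReal, h2]; simp
    simpa using this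
  have i3 : Integrable (fun y : ℝ => (1 : ℂ) + (u * Complex.I) * y) μ :=
    (integrable_const _).add (c1.const_mul _)
  have i4 : Integrable (fun y : ℝ => (1 : ℂ) + (u * Complex.I) * y - (u ^ 2 / 2) * (y : ℂ) ^ 2) μ :=
    i3.sub (c2.const_mul _)
  have eq : charFun μ u - (1 - (u : ℂ) ^ 2 / 2) = ∫ y : ℝ, (Complex.exp (u * y * Complex.I) -
      ((1 : ℂ) + (u * Complex.I) * y - (u ^ 2 / 2) * (y : ℂ) ^ 2)) ∂μ := by
    rw [integral_sub ie i4, integral_sub i3 (c2.const_mul _),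
      integral_add (integrable_const _) (c1.const_mul _), integral_const_mul, integral_const_mul,
      v1, v2, charFun_apply_real]
    simp
  rw [eq]
  have hb := norm_integral_le_of_norm_le (μ := μ)
    (f := fun y : ℝ => Complex.exp (u * y * Complex.I) -
      ((1 : ℂ) + (u * Complex.I) * y - (u ^ 2 / 2) * (y : ℂ) ^ 2))
    (g := fun y => 4 * |u| ^ 3 * (1 + y ^ 6)) (((integrable_const 1).add hi6).const_mul _)
    (ae_of_all _ fun y => ?_)
  · rw [integral_const_mul, integral_add (integrable_const _) hi6] at hb
    simp only [integral_const, probReal_univ, smul_eq_mul, mul_one] at hb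
    refine hb.trans ?_
    rw [mul_right_comm]
    gcongr
  · have := norm_exp_mul_I_sub_le (u * y)
    push_cast at this
    refine (le_of_eq ?_).trans (this.trans ?_)
    · congr 1; ring
    · rw [abs_mul, mul_pow, ← mul_assoc]
      gcongr
      have : y ^ 6 = (|y| ^ 3) ^ 2 := by
        rw [← pow_mul, Even.pow_abs (by decide)]
      rw [this]
      nlinarith [sq_nonneg (|y| ^ 3 - 1), sq_nonneg (|y| ^ 3)]

lemma norm_prod_sub_prod_le {ι : Type*} (s : Finset ι) (f g : ι → ℂ)
    (hf : ∀ i ∈ s, ‖f i‖ ≤ 1) (hg : ∀ i ∈ s, ‖g i‖ ≤ 1) :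
    ‖∏ i ∈ s, f i - ∏ i ∈ s, g i‖ ≤ ∑ i ∈ s, ‖f i - g i‖ := by
  classical
  induction s using Finset.induction_on with
  | empty => simp
  | insert a s ha ih =>
    have hf' := fun i hi => hf i (Finset.mem_insert_of_mem hi)
    have hg' := fun i hi => hg i (Finset.mem_insert_of_mem hi)
    rw [Finset.prod_insert ha, Finset.prod_insert ha, Finset.sum_insert ha]
    have e : f a * ∏ i ∈ s, f i - g a * ∏ i ∈ s, g i =
        (f a - g a) * ∏ i ∈ s, f i + g a * (∏ i ∈ s, f i - ∏ i ∈ s, g i) := by ring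
    rw [e]
    refine (norm_add_le _ _).trans (add_le_add ?_ ?_)
    · rw [norm_mul]
      refine mul_le_of_le_one_right (norm_nonneg _) ?_
      rw [norm_prod]
      exact Finset.prod_le_one (fun _ _ => norm_nonneg _) hf'
    · rw [norm_mul]
      exact (mul_le_of_le_one_left (norm_nonneg _) (hg a (Finset.mem_insert_self _ _))).trans
        (ih hf' hg')

lemma norm_exp_neg_sub_le {x : ℝ} (h0 : 0 ≤ x) (h1 : x ≤ 1) :
    ‖Complex.exp (-(x : ℂ)) - (1 - x)‖ ≤ x ^ 2 := by
  have := Complex.norm_exp_sub_one_sub_id_le (x := -(x : ℂ)) (by simpa [abs_of_nonneg h0] using h1)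
  simp only [norm_neg, Complex.norm_real, Real.norm_eq_abs, sq_abs] at this
  convert this using 2
  ring

/-- A central limit theorem for sums along a sequence of finite subfamilies of an independent
family of standardized random variables with bounded sixth moments. -/
theorem tendstoInDistribution_inv_sqrt_card_mul_sum {ι Ω : Type*} [MeasurableSpace Ω]
    {P : Measure Ω} [IsProbabilityMeasure P] {w : ι → Ω → ℝ} (hw : ∀ i, Measurable (w i))
    (hind : iIndepFun w P) {κ : ℝ} (h1 : ∀ i, ∫ ω, w i ω ∂P = 0)
    (hi2 : ∀ i, Integrable (fun ω => w i ω ^ 2) P) (h2 : ∀ i, ∫ ω, w i ω ^ 2 ∂P = 1)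
    (hi6 : ∀ i, Integrable (fun ω => w i ω ^ 6) P) (h6 : ∀ i, ∫ ω, w i ω ^ 6 ∂P ≤ κ)
    {T : ℕ → Finset ι} (hT : Tendsto (fun n => (T n).card) atTop atTop) :
    TendstoInDistribution (fun (n : ℕ) ω => (√((T n).card : ℝ))⁻¹ * ∑ i ∈ T n, w i ω) atTop
      (id : ℝ → ℝ) (fun _ => P) (gaussianReal 0 1) where
  forall_aemeasurable n := by
    have := Finset.measurable_fun_sum (T n) (f := w) fun i _ => hw i
    exact (this.const_mul _).aemeasurable
  tendsto := by
    refine ProbabilityMeasure.tendsto_iff_tendsto_charFun.2 fun t => ?_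
    simp only [ProbabilityMeasure.coe_mk, Measure.map_id, charFun_gaussianReal]
    have hcf : ∀ n, charFun (P.map fun ω => (√((T n).card : ℝ))⁻¹ * ∑ i ∈ T n, w i ω) t =
        ∏ i ∈ T n, charFun (P.map (w i)) ((√((T n).card : ℝ))⁻¹ * t) := fun n => by
      rw [charFun_map_mul_comp (Finset.measurable_fun_sum (T n) fun i _ => hw i).aemeasurable,
        (hind.restrict _).charFun_map_fun_finsetSum_eq_prod (fun i _ => (hw i).aemeasurable),
        Finset.prod_apply]
    simp only [hcf]
    rw [tendsto_iff_norm_sub_tendsto_zero]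
    have hL : Tendsto (fun n => ((T n).card : ℝ)) atTop atTop :=
      tendsto_natCast_atTop_atTop.comp hT
    have hu : Tendsto (fun n => (√((T n).card : ℝ))⁻¹) atTop (nhds 0) :=
      tendsto_inv_atTop_zero.comp (Real.tendsto_sqrt_atTop.comp hL)
    have hb : Tendsto (fun n => (√((T n).card : ℝ))⁻¹ * (4 * (1 + κ) * |t| ^ 3)
        + (√((T n).card : ℝ))⁻¹ ^ 2 * t ^ 4) atTop (nhds 0) := by
      have := (hu.mul_const (4 * (1 + κ) * |t| ^ 3)).add ((hu.pow 2).mul_const (t ^ 4))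
      simpa using this
    refine squeeze_zero' (Eventually.of_forall fun _ => norm_nonneg _) ?_ hb
    filter_upwards [hL.eventually_ge_atTop (t ^ 2), hL.eventually_ge_atTop 1] with n hn hn1
    set L : ℝ := ((T n).card : ℝ) with hLdef
    set v := (√L)⁻¹ with hv
    have hL0 : 0 < L := by linarith
    have hv0 : 0 < v := by positivity
    have hv2 : v ^ 2 * L = 1 := by
      rw [hv, inv_pow, Real.sq_sqrt hL0.le, inv_mul_cancel₀ hL0.ne']
    -- The Gaussian characteristic function is split into `L` equal factors and compared factor by
    -- factor. Each error is O(v³) and `L = v⁻²`, so the total is O(v).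
    have hexp : Complex.exp (t * (0 : ℝ) * Complex.I - (1 : NNReal) * (t : ℂ) ^ 2 / 2) =
        ∏ i ∈ T n, Complex.exp (-(((v * t) ^ 2 / 2 : ℝ) : ℂ)) := by
      rw [Finset.prod_const, ← Complex.exp_nat_mul]
      congr 1
      have : ((T n).card : ℂ) * ((v * t) ^ 2 / 2 : ℝ) = (((v ^ 2 * L) * (t ^ 2 / 2) : ℝ) : ℂ) := by
        rw [hLdef]; push_cast; ring
      rw [mul_neg, this, hv2]
      push_cast
      simp
    have hx0 : 0 ≤ (v * t) ^ 2 / 2 := by positivity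
    have hx1 : (v * t) ^ 2 / 2 ≤ 1 := by
      rw [mul_pow]
      nlinarith [sq_nonneg v]
    rw [hexp]
    refine (norm_prod_sub_prod_le _ _ _ (fun i _ => ?_) (fun i _ => ?_)).trans ?_
    · have := Measure.isProbabilityMeasure_map (μ := P) (hw i).aemeasurable
      exact norm_charFun_le_one _
    · rw [← Complex.ofReal_neg, Complex.norm_exp_ofReal, Real.exp_le_one_iff]
      linarith
    · have term : ∀ i ∈ T n, ‖charFun (P.map (w i)) (v * t) -
          Complex.exp (-(((v * t) ^ 2 / 2 : ℝ) : ℂ))‖ ≤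
          4 * (1 + κ) * |v * t| ^ 3 + ((v * t) ^ 2 / 2) ^ 2 := by
        intro i _
        have hp := Measure.isProbabilityMeasure_map (μ := P) (hw i).aemeasurable
        have a1 := norm_charFun_sub_le (μ := P.map (w i)) (κ := κ)
          ((integrable_map_measure (by fun_prop) (hw i).aemeasurable).2 (hi2 i))
          (by rw [integral_map (hw i).aemeasurable (by fun_prop)]; exact h1 i)
          (by rw [integral_map (hw i).aemeasurable (by fun_prop)]; exact h2 i)
          ((integrable_map_measure (by fun_prop) (hw i).aemeasurable).2 (hi6 i))
          (by rw [integral_map (hw i).aemeasurable (by fun_prop)]; exact h6 i) (v * t)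
        have a2 := norm_exp_neg_sub_le hx0 hx1
        rw [norm_sub_rev] at a2
        have e : (1 : ℂ) - (((v * t) ^ 2 / 2 : ℝ) : ℂ) = 1 - ((v * t : ℝ) : ℂ) ^ 2 / 2 := by
          push_cast; ring
        rw [e] at a2
        exact (norm_sub_le_norm_sub_add_norm_sub _ _ _).trans (add_le_add a1 a2)
      refine (Finset.sum_le_sum term).trans ?_
      rw [Finset.sum_const, nsmul_eq_mul, ← hLdef, abs_mul, abs_of_pos hv0]
      have e1 : L * (4 * (1 + κ) * (v * |t|) ^ 3 + ((v * t) ^ 2 / 2) ^ 2) =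
          (v ^ 2 * L) * (v * (4 * (1 + κ) * |t| ^ 3)) + (v ^ 2 * L) * (v ^ 2 * t ^ 4 / 4) := by ring
      rw [e1, hv2]
      have : 0 ≤ v ^ 2 * t ^ 4 := by positivity
      linarith

/-! ### Countably many test functions for weak convergence -/

/-- The tent function supported on the interval from `q.1` to `q.2`. -/
noncomputable def tent (q : ℚ × ℚ) (x : ℝ) : ℝ := max 0 (min (x - q.1) (q.2 - x))

lemma tent_nonneg (q : ℚ × ℚ) (x : ℝ) : 0 ≤ tent q x := le_max_left _ _

lemma tent_pos_iff (q : ℚ × ℚ) (x : ℝ) : 0 < tent q x ↔ x ∈ Set.Ioo (q.1 : ℝ) q.2 := by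
  simp [tent, Set.mem_Ioo]

lemma abs_tent_sub_le (q : ℚ × ℚ) (x y : ℝ) : |tent q x - tent q y| ≤ |x - y| := by
  have key : ∀ x y : ℝ, tent q x - tent q y ≤ |x - y| := fun x y => by
    have h1 := le_abs_self (x - y)
    have h2 := neg_abs_le (x - y)
    have h3 := abs_nonneg (x - y)
    rw [sub_le_iff_le_add, tent]
    refine max_le (add_nonneg h3 (tent_nonneg q y)) ?_
    have hm : min (x - q.1) (q.2 - x) ≤ |x - y| + min (y - q.1) (q.2 - y) := by
      rw [← min_add_add_left]
      exact min_le_min (by linarith) (by linarith)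
    exact hm.trans (add_le_add_right (le_max_right _ _) _)
  exact abs_sub_le_iff.2 ⟨key x y, (key y x).trans_eq (abs_sub_comm _ _)⟩

/-- A countable family of Lipschitz functions with values in `[0,1]` which determines weak
convergence on the real line. -/
noncomputable def testFun (j : Σ k : ℕ, Fin k → ℚ × ℚ) (x : ℝ) : ℝ :=
  min 1 (j.1 * ∑ i, tent (j.2 i) x)

lemma testFun_nonneg (j : Σ k : ℕ, Fin k → ℚ × ℚ) (x : ℝ) : 0 ≤ testFun j x :=
  le_min zero_le_one (mul_nonneg (Nat.cast_nonneg _) (Finset.sum_nonneg fun _ _ => tent_nonneg _ _))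

lemma testFun_le_one (j : Σ k : ℕ, Fin k → ℚ × ℚ) (x : ℝ) : testFun j x ≤ 1 := min_le_left _ _

lemma abs_testFun_sub_le (j : Σ k : ℕ, Fin k → ℚ × ℚ) (x y : ℝ) :
    |testFun j x - testFun j y| ≤ (j.1 * j.1 : ℝ) * |x - y| := by
  refine (abs_min_sub_min_le_max _ _ _ _).trans (max_le (by simp; positivity) ?_)
  rw [← mul_sub, abs_mul, Nat.abs_cast, mul_assoc, ← Finset.sum_sub_distrib]
  gcongr
  refine (Finset.abs_sum_le_sum_abs _ _).trans
    ((Finset.sum_le_sum fun i _ => abs_tent_sub_le (j.2 i) x y).trans_eq ?_)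
  simp

lemma continuous_of_abs_sub_le {ψ : ℝ → ℝ} {κ : ℝ} (hκ : 0 ≤ κ)
    (h : ∀ x y, |ψ x - ψ y| ≤ κ * |x - y|) : Continuous ψ :=
  (LipschitzWith.of_dist_le_mul (K := κ.toNNReal) fun x y => by
    rw [Real.dist_eq, Real.dist_eq, Real.coe_toNNReal _ hκ]
    exact h x y).continuous

lemma continuous_testFun (j : Σ k : ℕ, Fin k → ℚ × ℚ) : Continuous (testFun j) :=
  continuous_of_abs_sub_le (by positivity) (abs_testFun_sub_le j)

lemma abs_testFun_le_one (j : Σ k : ℕ, Fin k → ℚ × ℚ) (x : ℝ) : |testFun j x| ≤ 1 := by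
  rw [abs_of_nonneg (testFun_nonneg j x)]
  exact testFun_le_one j x

lemma le_sum_fin (v : ℕ → ℝ) (hv : ∀ i, 0 ≤ v i) {n k : ℕ} (h : n < k) :
    v n ≤ ∑ i : Fin k, v i := by
  rw [Fin.sum_univ_eq_sum_range]
  exact Finset.single_le_sum (fun i _ => hv i) (Finset.mem_range.2 h)

/-- Rational intervals inside `G` cover it, so at each point of `G` some tent is positive; the
growing factor `k` and the cap at 1 then force the value 1 eventually. -/
lemma exists_testFun_tendsto_indicator {G : Set ℝ} (hG : IsOpen G) :
    ∃ j : ℕ → Σ k : ℕ, Fin k → ℚ × ℚ, (∀ k, ∀ x ∉ G, testFun (j k) x = 0) ∧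
      ∀ x, Tendsto (fun k => testFun (j k) x) atTop (nhds (G.indicator (fun _ => 1) x)) := by
  classical
  obtain ⟨q₀, hq₀⟩ := exists_surjective_nat (ℚ × ℚ)
  -- Intervals not contained in `G` are replaced by the empty one, whose tent is zero.
  set q : ℕ → ℚ × ℚ := fun n =>
    if Set.Ioo ((q₀ n).1 : ℝ) (q₀ n).2 ⊆ G then q₀ n else (0, 0) with hq
  have hqG : ∀ n, Set.Ioo ((q n).1 : ℝ) (q n).2 ⊆ G := fun n => by
    simp only [hq]
    split_ifs with h
    · exact h
    · simp
  have hout : ∀ n, ∀ x ∉ G, tent (q n) x = 0 := fun n x hx => by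
    refine le_antisymm (not_lt.1 fun h => hx (hqG n ((tent_pos_iff _ _).1 h))) (tent_nonneg _ _)
  have hin : ∀ x ∈ G, ∃ n, 0 < tent (q n) x := fun x hx => by
    obtain ⟨v, hv, hxv, hvG⟩ :=
      Real.isTopologicalBasis_Ioo_rat.exists_subset_of_mem_open hx hG
    simp only [Set.mem_iUnion, Set.mem_singleton_iff] at hv
    obtain ⟨a, b, _, rfl⟩ := hv
    obtain ⟨n, hn⟩ := hq₀ (a, b)
    refine ⟨n, (tent_pos_iff _ _).2 ?_⟩
    have : q n = (a, b) := by
      simp only [hq, hn]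
      rw [if_pos hvG]
    rw [this]
    exact hxv
  clear_value q
  have hzero : ∀ k : ℕ, ∀ x ∉ G, testFun ⟨k, fun i => q i⟩ x = 0 := fun k x hx => by
    simp [testFun, hout _ x hx]
  refine ⟨fun k => ⟨k, fun i => q i⟩, hzero, fun x => ?_⟩
  by_cases hx : x ∈ G
  · obtain ⟨n, hn⟩ := hin x hx
    rw [Set.indicator_of_mem hx]
    refine tendsto_const_nhds.congr' ?_
    obtain ⟨l, hl⟩ := exists_nat_ge (1 / tent (q n) x)
    filter_upwards [eventually_ge_atTop (max l (n + 1))] with k hk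
    have hkn : n < k := by have := le_of_max_le_right hk; lia
    have hkl : (l : ℝ) ≤ k := by exact_mod_cast le_of_max_le_left hk
    have h1 : tent (q n) x ≤ ∑ i : Fin k, tent (q i) x :=
      le_sum_fin (fun i => tent (q i) x) (fun i => tent_nonneg _ _) hkn
    have h2 : 1 / tent (q n) x * tent (q n) x ≤ (k : ℝ) * ∑ i : Fin k, tent (q i) x :=
      mul_le_mul (hl.trans hkl) h1 (tent_nonneg _ _) (Nat.cast_nonneg _)
    rw [one_div_mul_cancel hn.ne'] at h2
    exact (min_eq_left h2).symm
  · rw [Set.indicator_of_notMem hx]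
    refine tendsto_const_nhds.congr fun k => ?_
    rw [hzero k x hx]

/-- Portmanteau criterion for open sets: test functions below the indicator of `G` bound the liminf
of the masses of `G` from below, and their integrals converge to the limiting mass. -/
theorem tendsto_of_forall_integral_testFun {μs : ℕ → ProbabilityMeasure ℝ}
    {μ : ProbabilityMeasure ℝ}
    (h : ∀ j, Tendsto (fun n => ∫ x, testFun j x ∂(μs n : Measure ℝ)) atTop
      (nhds (∫ x, testFun j x ∂(μ : Measure ℝ)))) :
    Tendsto μs atTop (nhds μ) := by
  refine tendsto_of_forall_isOpen_le_liminf_nat' fun G hG => ?_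
  obtain ⟨j, hj0, hj⟩ := exists_testFun_tendsto_indicator hG
  have hlim : Tendsto (fun k => ∫ x, testFun (j k) x ∂(μ : Measure ℝ)) atTop
      (nhds ((μ : Measure ℝ).real G)) := by
    have := tendsto_integral_of_dominated_convergence (μ := (μ : Measure ℝ)) (fun _ => (1 : ℝ))
      (fun k => (continuous_testFun (j k)).aestronglyMeasurable) (integrable_const _)
      (fun k => ae_of_all _ fun x => abs_testFun_le_one (j k) x) (ae_of_all _ hj)
    rwa [integral_indicator_const _ hG.measurableSet, smul_eq_mul, mul_one] at this
  have hle : ∀ (ν : ProbabilityMeasure ℝ) k,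
      ∫ x, testFun (j k) x ∂(ν : Measure ℝ) ≤ (ν : Measure ℝ).real G := fun ν k => by
    rw [← mul_one ((ν : Measure ℝ).real G), ← smul_eq_mul,
      ← integral_indicator_const _ hG.measurableSet]
    refine integral_mono (integrable_of_abs_le (continuous_testFun _).measurable 1
      (abs_testFun_le_one _)) ((integrable_const _).indicator hG.measurableSet) fun x => ?_
    by_cases hx : x ∈ G
    · rw [Set.indicator_of_mem hx]
      exact testFun_le_one _ _
    · rw [hj0 k x hx]
      exact Set.indicator_nonneg (fun _ _ => zero_le_one) _
  refine le_of_forall_lt fun r hr => ?_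
  have hr' : r ≠ ⊤ := ne_top_of_lt hr
  have hr1 : r.toReal < (μ : Measure ℝ).real G :=
    (ENNReal.toReal_lt_toReal hr' (measure_ne_top _ _)).2 hr
  obtain ⟨s, hs1, hs2⟩ := exists_between hr1
  obtain ⟨k, hk⟩ := (hlim.eventually_const_lt hs2).exists
  have hev := (h (j k)).eventually_const_lt hk
  have hs0 : 0 ≤ s := ENNReal.toReal_nonneg.trans hs1.le
  refine (?_ : r < ENNReal.ofReal s).trans_le (le_liminf_of_le (by isBoundedDefault) ?_)
  · rwa [← ENNReal.ofReal_toReal hr', ENNReal.ofReal_lt_ofReal_iff_of_nonneg ENNReal.toReal_nonneg]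
  · filter_upwards [hev] with n hn
    exact ENNReal.ofReal_le_of_le_toReal (hn.le.trans (hle (μs n) k))

/-! ### Quenched averages as functions of the environment -/

lemma ae_tendsto_zero_of_summable_integral {Ω : Type*} [MeasurableSpace Ω] {P : Measure Ω}
    {Y : ℕ → Ω → ℝ} (hY : ∀ n, Integrable (Y n) P) (h0 : ∀ n ω, 0 ≤ Y n ω)
    (hs : Summable fun n => ∫ ω, Y n ω ∂P) : ∀ᵐ ω ∂P, Tendsto (fun n => Y n ω) atTop (nhds 0) := by
  have hm : ∀ n, AEMeasurable (fun ω => ENNReal.ofReal (Y n ω)) P := fun n =>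
    (hY n).aemeasurable.ennreal_ofReal
  have hfin : ∫⁻ ω, ∑' n, ENNReal.ofReal (Y n ω) ∂P ≠ ⊤ := by
    rw [lintegral_tsum hm]
    have : ∀ n, ∫⁻ ω, ENNReal.ofReal (Y n ω) ∂P = ENNReal.ofReal (∫ ω, Y n ω ∂P) := fun n =>
      (ofReal_integral_eq_lintegral_ofReal (hY n) (ae_of_all _ (h0 n))).symm
    simp only [this]
    exact hs.tsum_ofReal_ne_top
  filter_upwards [ae_lt_top' (AEMeasurable.tsum hm) hfin] with ω hω
  have := ENNReal.tendsto_atTop_zero_of_tsum_ne_top hω.ne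
  have h2 := (ENNReal.tendsto_toReal ENNReal.zero_ne_top).comp this
  refine h2.congr fun n => ?_
  simp [ENNReal.toReal_ofReal (h0 n ω)]

lemma tendsto_zero_of_pow {ι : Type*} {l : Filter ι} {x : ι → ℝ} {k : ℕ}
    (h : Tendsto (fun i => x i ^ k) l (nhds 0)) : Tendsto x l (nhds 0) := by
  rw [Metric.tendsto_nhds] at h ⊢
  intro ε hε
  filter_upwards [h (ε ^ k) (by positivity)] with i hi
  simp only [dist_zero_right, norm_pow] at hi ⊢
  exact lt_of_pow_lt_pow_left₀ k hε.le hi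

lemma choose_pos_real (m k : ℕ) : (0 : ℝ) < (m + k).choose m := by
  exact_mod_cast Nat.choose_pos (Nat.le_add_right m k)

lemma abs_pathAverage_sub_le (m k : ℕ) (F G : Finset (ℕ+ × ℕ+) → ℝ) :
    |pathAverage (m + k) m F - pathAverage (m + k) m G| ≤
      pathAverage (m + k) m (fun π => |F π - G π|) := by
  unfold pathAverage
  rw [← sub_div, ← Finset.sum_sub_distrib, abs_div, abs_of_pos (choose_pos_real m k)]
  exact div_le_div_of_nonneg_right (Finset.abs_sum_le_sum_abs _ _) (choose_pos_real m k).le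

lemma pathAverage_mono (n m : ℕ) {F G : Finset (ℕ+ × ℕ+) → ℝ} (h : ∀ π, F π ≤ G π) :
    pathAverage n m F ≤ pathAverage n m G :=
  div_le_div_of_nonneg_right (Finset.sum_le_sum fun _ _ => h _) (Nat.cast_nonneg _)

lemma pathAverage_const (m k : ℕ) (c : ℝ) : pathAverage (m + k) m (fun _ => c) = c := by
  unfold pathAverage
  rw [Finset.sum_const, Finset.card_powersetCard, Finset.card_range, nsmul_eq_mul,
    mul_div_cancel_left₀ _ (choose_pos_real m k).ne']

/-- Some path is at least as far from `ℓ` as the average. -/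
lemma exists_abs_pathAverage_sub_le (m k : ℕ) (F : Finset (ℕ+ × ℕ+) → ℝ) (ℓ : ℝ) :
    ∃ A : Finset ℕ, |pathAverage (m + k) m F - ℓ| ≤ |F (latticePath (m + k) A) - ℓ| := by
  by_contra! hcon
  have h1 := abs_pathAverage_sub_le m k F (fun _ => ℓ)
  rw [pathAverage_const] at h1
  set D := |pathAverage (m + k) m F - ℓ|
  have h2 : pathAverage (m + k) m (fun π => |F π - ℓ|) < pathAverage (m + k) m (fun _ => D) := by
    unfold pathAverage
    refine div_lt_div_of_pos_right (Finset.sum_lt_sum_of_nonempty ?_ fun A _ => hcon A)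
      (choose_pos_real m k)
    exact Finset.powersetCard_nonempty.2 (by simp)
  rw [pathAverage_const] at h2
  linarith

/-- The average over the paths of `ψ` of the normalized energy in the environment `x`. -/
noncomputable def quenched (ψ : ℝ → ℝ) (m k : ℕ) (x : ℕ+ × ℕ+ → ℝ) : ℝ :=
  pathAverage (m + k) m (fun π => ψ ((√((m : ℝ) + k + 1))⁻¹ * pathEnergy x π))

lemma measurable_quenched {ψ : ℝ → ℝ} (hψ : Measurable ψ) (m k : ℕ) :
    Measurable (quenched ψ m k) := by
  unfold quenched pathAverage pathEnergy
  refine (Finset.measurable_fun_sum _ fun A _ => hψ.comp ?_).div_const _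
  exact (Finset.measurable_fun_sum _ fun a _ => measurable_pi_apply a).const_mul _

lemma abs_quenched_le {ψ : ℝ → ℝ} {B : ℝ} (hB : ∀ x, |ψ x| ≤ B) (m k : ℕ) (x : ℕ+ × ℕ+ → ℝ) :
    |quenched ψ m k x| ≤ B := by
  unfold quenched
  have h0 := pathAverage_const m k 0
  have := abs_pathAverage_sub_le m k
    (fun π => ψ ((√((m : ℝ) + k + 1))⁻¹ * pathEnergy x π)) (fun _ => 0)
  rw [h0, sub_zero] at this
  refine this.trans ((pathAverage_mono _ _ fun π => ?_).trans_eq (pathAverage_const m k B))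
  rw [sub_zero]
  exact hB _

/-- Averaging over paths weights the influence of each square by its visit probability; this is the
source of the concentration. -/
lemma abs_quenched_sub_le {ψ : ℝ → ℝ} {κ : ℝ} (hκ : 0 ≤ κ)
    (hψ : ∀ x y, |ψ x - ψ y| ≤ κ * |x - y|) (m k : ℕ) (x y : ℕ+ × ℕ+ → ℝ) :
    |quenched ψ m k x - quenched ψ m k y| ≤ ∑ a ∈ reachableSquares (m + k) m,
      (κ * (√((m : ℝ) + k + 1))⁻¹ * visitProb (m + k) m a) * |x a - y a| := by
  refine (abs_pathAverage_sub_le m k _ _).trans ?_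
  have h : ∀ π : Finset (ℕ+ × ℕ+),
      |ψ ((√((m : ℝ) + k + 1))⁻¹ * pathEnergy x π) - ψ ((√((m : ℝ) + k + 1))⁻¹ * pathEnergy y π)| ≤
        ∑ a ∈ π, κ * (√((m : ℝ) + k + 1))⁻¹ * |x a - y a| := fun π => by
    refine (hψ _ _).trans ?_
    rw [← mul_sub, abs_mul, abs_of_nonneg (inv_nonneg.2 (Real.sqrt_nonneg _)), ← Finset.mul_sum,
      ← mul_assoc, pathEnergy, pathEnergy, ← Finset.sum_sub_distrib]
    gcongr
    exact Finset.abs_sum_le_sum_abs _ _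
  refine (pathAverage_mono _ _ h).trans_eq ?_
  rw [pathAverage, sum_sum_latticePath]
  refine Finset.sum_congr rfl fun a _ => ?_
  ring

/-! ### Concentration and almost sure convergence of quenched averages -/

section Environment

variable {Ω : Type*} [MeasurableSpace Ω] {P : Measure Ω} [IsProbabilityMeasure P]
  {w : ℕ+ × ℕ+ → Ω → ℝ} {ψ : ℝ → ℝ} {β κ c : ℝ}

/-- With `v = L^(-1/2)`, the squared influences sum to `β² v²` times O(√L), that is O(v). Taking `ε
= v` in the concentration bound keeps this order. -/
lemma integral_quenched_sub_pow_six_le (hw : ∀ a, Measurable (w a)) (hind : iIndepFun w P)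
    (hκ : 1 ≤ κ)
    (hi2 : ∀ a, Integrable (fun ω => w a ω ^ 2) P) (h2 : ∀ a, ∫ ω, w a ω ^ 2 ∂P = 1)
    (hi6 : ∀ a, Integrable (fun ω => w a ω ^ 6) P) (h6 : ∀ a, ∫ ω, w a ω ^ 6 ∂P ≤ κ)
    (hβ : 0 ≤ β) (hψ : ∀ x y, |ψ x - ψ y| ≤ β * |x - y|) (hψ1 : ∀ x, |ψ x| ≤ 1)
    (hc : 0 < c) {m k : ℕ} (hn : 2 ≤ m + k) (hm : c * ((m : ℝ) + k + 2) ≤ m + 1)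
    (hk : c * ((m : ℝ) + k + 2) ≤ k + 1) :
    ∫ ω, (quenched ψ m k (fun a => w a ω) - ∫ ω', quenched ψ m k (fun a => w a ω') ∂P) ^ 6 ∂P ≤
      (1 + 52 * κ * (β ^ 2 * (8 / c ^ 2))) ^ 3 * ((√((m : ℝ) + k + 1))⁻¹) ^ 3 := by
  set v : ℝ := (√((m : ℝ) + k + 1))⁻¹ with hv
  have hL : (0 : ℝ) < (m : ℝ) + k + 1 := by positivity
  have hv0 : 0 < v := by positivity
  refine (integral_sub_integral_pow_six_le hw hind hκ hi2 (fun a => (h2 a).le) hi6 h6 hv0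
    (c := fun a => β * v * visitProb (m + k) m a)
    (fun a => mul_nonneg (by positivity) (visitProb_nonneg _ _ _))
    (reachableSquares (m + k) m) (quenched ψ m k)
    (measurable_quenched (continuous_of_abs_sub_le hβ hψ).measurable m k) 1
    (abs_quenched_le hψ1 m k) (abs_quenched_sub_le hβ hψ m k)).trans ?_
  rw [← mul_pow]
  have hsum := sum_visitProb_sq_le (m + k) m k rfl hn hc (by push_cast; exact hm)
    (by push_cast; exact hk)
  push_cast at hsum
  have h0 : 0 ≤ ∑ a ∈ reachableSquares (m + k) m, (β * v * visitProb (m + k) m a) ^ 2 :=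
    Finset.sum_nonneg fun _ _ => sq_nonneg _
  refine pow_le_pow_left₀ (by positivity) ?_ 3
  have e : ∑ a ∈ reachableSquares (m + k) m, (β * v * visitProb (m + k) m a) ^ 2 =
      β ^ 2 * v ^ 2 * ∑ a ∈ reachableSquares (m + k) m, visitProb (m + k) m a ^ 2 := by
    rw [Finset.mul_sum]
    refine Finset.sum_congr rfl fun a _ => ?_
    ring
  have hvs : v * √((m : ℝ) + k + 1) = 1 := inv_mul_cancel₀ (Real.sqrt_pos.2 hL).ne'
  rw [e]
  calc v + 52 * κ * (β ^ 2 * v ^ 2 *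
        ∑ a ∈ reachableSquares (m + k) m, visitProb (m + k) m a ^ 2)
      ≤ v + 52 * κ * (β ^ 2 * v ^ 2 * (8 / c ^ 2 * √((m : ℝ) + k + 1))) := by gcongr
    _ = v + 52 * κ * (β ^ 2 * (8 / c ^ 2)) * v * (v * √((m : ℝ) + k + 1)) := by ring
    _ = _ := by rw [hvs]; ring

lemma tendsto_integral_quenched (hw : ∀ a, Measurable (w a)) (hind : iIndepFun w P)
    (h1 : ∀ a, ∫ ω, w a ω ∂P = 0)
    (hi2 : ∀ a, Integrable (fun ω => w a ω ^ 2) P) (h2 : ∀ a, ∫ ω, w a ω ^ 2 ∂P = 1)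
    (hi6 : ∀ a, Integrable (fun ω => w a ω ^ 6) P) (h6 : ∀ a, ∫ ω, w a ω ^ 6 ∂P ≤ κ)
    (hψ : Continuous ψ) (hψ1 : ∀ x, |ψ x| ≤ 1) {m k : ℕ → ℕ}
    (hmk : Tendsto (fun N => m N + k N) atTop atTop) :
    Tendsto (fun N => ∫ ω, quenched ψ (m N) (k N) (fun a => w a ω) ∂P) atTop
      (nhds (∫ x, ψ x ∂(gaussianReal 0 1))) := by
  set ℓ := ∫ x, ψ x ∂(gaussianReal 0 1)
  set F : ℕ → Finset (ℕ+ × ℕ+) → ℝ := fun N π =>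
    ∫ ω, ψ ((√((m N : ℝ) + k N + 1))⁻¹ * pathEnergy (fun a => w a ω) π) ∂P with hF
  have hmeas : ∀ (v : ℝ) (π : Finset (ℕ+ × ℕ+)),
      Measurable fun ω => v * pathEnergy (fun a => w a ω) π := fun v π =>
    (Finset.measurable_fun_sum _ fun a _ => hw a).const_mul v
  have hEq : ∀ N, ∫ ω, quenched ψ (m N) (k N) (fun a => w a ω) ∂P =
      pathAverage (m N + k N) (m N) (F N) := fun N => by
    unfold quenched pathAverage
    rw [integral_div, integral_finsetSum]
    exact fun A _ => integrable_of_abs_le (hψ.measurable.comp (hmeas _ _)) 1 fun _ => hψ1 _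
  -- A worst path for each `N` reduces uniformity over paths to the CLT along a single sequence of
  -- paths.
  choose A hA using fun N => exists_abs_pathAverage_sub_le (m N) (k N) (F N) ℓ
  have hcard : ∀ N, (latticePath (m N + k N) (A N)).card = m N + k N + 1 := fun N =>
    card_latticePath _ _
  have hclt := tendstoInDistribution_inv_sqrt_card_mul_sum hw hind h1 hi2 h2 hi6 h6
    (T := fun N => latticePath (m N + k N) (A N))
    (by simp only [hcard]; exact tendsto_add_atTop_nat 1 |>.comp hmk)
  have hψb := (ProbabilityMeasure.tendsto_iff_forall_integral_tendsto.1 hclt.tendsto)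
    (BoundedContinuousFunction.ofNormedAddCommGroup ψ hψ 1 hψ1)
  simp only [ProbabilityMeasure.coe_mk, Measure.map_id,
    BoundedContinuousFunction.coe_ofNormedAddCommGroup] at hψb
  have hFl : Tendsto (fun N => F N (latticePath (m N + k N) (A N))) atTop (nhds ℓ) := by
    refine hψb.congr fun N => ?_
    rw [integral_map (hclt.forall_aemeasurable N) hψ.aestronglyMeasurable, hcard]
    push_cast
    rfl
  simp only [hEq]
  rw [tendsto_iff_norm_sub_tendsto_zero] at hFl ⊢
  exact squeeze_zero (fun _ => norm_nonneg _) hA hFl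

/-- Almost sure convergence of the path averages of a bounded Lipschitz function. -/
theorem ae_tendsto_quenched (hw : ∀ a, Measurable (w a)) (hind : iIndepFun w P)
    (hκ : 1 ≤ κ) (h1 : ∀ a, ∫ ω, w a ω ∂P = 0)
    (hi2 : ∀ a, Integrable (fun ω => w a ω ^ 2) P) (h2 : ∀ a, ∫ ω, w a ω ^ 2 ∂P = 1)
    (hi6 : ∀ a, Integrable (fun ω => w a ω ^ 6) P) (h6 : ∀ a, ∫ ω, w a ω ^ 6 ∂P ≤ κ)
    (hβ : 0 ≤ β) (hψ : ∀ x y, |ψ x - ψ y| ≤ β * |x - y|) (hψ1 : ∀ x, |ψ x| ≤ 1)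
    (hc : 0 < c) {m k : ℕ → ℕ} (hN : ∀ᶠ N in atTop, N ≤ m N + k N + 1)
    (hm : ∀ᶠ N in atTop, c * ((m N : ℝ) + k N + 2) ≤ m N + 1)
    (hk : ∀ᶠ N in atTop, c * ((m N : ℝ) + k N + 2) ≤ k N + 1) :
    ∀ᵐ ω ∂P, Tendsto (fun N => quenched ψ (m N) (k N) (fun a => w a ω)) atTop
      (nhds (∫ x, ψ x ∂(gaussianReal 0 1))) := by
  have hcont := continuous_of_abs_sub_le hβ hψ
  have hmk : Tendsto (fun N => m N + k N) atTop atTop := by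
    refine tendsto_atTop_mono' _ ?_ (tendsto_sub_atTop_nat 1)
    filter_upwards [hN] with N hN
    lia
  have hE := tendsto_integral_quenched hw hind h1 hi2 h2 hi6 h6 hcont hψ1 hmk
  set E : ℕ → ℝ := fun N => ∫ ω, quenched ψ (m N) (k N) (fun a => w a ω) ∂P with hEdef
  have hqm : ∀ N, Measurable fun ω => quenched ψ (m N) (k N) (fun a => w a ω) := fun N =>
    (measurable_quenched hcont.measurable _ _).comp (measurable_pi_lambda _ hw)
  have hEb : ∀ N, |E N| ≤ 1 := fun N => by
    have := norm_integral_le_of_norm_le_const (μ := P)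
      (f := fun ω => quenched ψ (m N) (k N) (fun a => w a ω))
      (C := 1) (ae_of_all _ fun ω => abs_quenched_le hψ1 _ _ _)
    simpa using this
  have hsum : Summable fun N =>
      ∫ ω, (quenched ψ (m N) (k N) (fun a => w a ω) - E N) ^ 6 ∂P := by
    set C : ℝ := (1 + 52 * κ * (β ^ 2 * (8 / c ^ 2))) ^ 3
    have hC : 0 ≤ C := by positivity
    have hs : Summable fun N : ℕ => C * (1 / (N : ℝ) ^ (3 / 2 : ℝ)) :=
      (Real.summable_one_div_nat_rpow.2 (by norm_num)).mul_left C
    refine Summable.of_norm_bounded_eventually_nat hs ?_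
    filter_upwards [hN, hm, hk, hmk.eventually_ge_atTop 2, eventually_ge_atTop 1]
      with N a1 a2 a3 a4 a5
    rw [Real.norm_of_nonneg (integral_nonneg fun ω => Even.pow_nonneg (by decide) _)]
    refine (integral_quenched_sub_pow_six_le hw hind hκ hi2 h2 hi6 h6 hβ hψ hψ1 hc a4 a2 a3).trans ?_
    refine mul_le_mul_of_nonneg_left ?_ hC
    have hN0 : (0 : ℝ) < N := by exact_mod_cast a5
    have hNle : (N : ℝ) ≤ (m N : ℝ) + k N + 1 := by exact_mod_cast a1
    have e : (N : ℝ) ^ (3 / 2 : ℝ) = √(N : ℝ) ^ 3 := by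
      rw [Real.sqrt_eq_rpow, ← Real.rpow_natCast, ← Real.rpow_mul hN0.le]
      norm_num
    rw [e, inv_pow, one_div]
    have : 0 < √(N : ℝ) := Real.sqrt_pos.2 hN0
    gcongr
  have hint : ∀ N, Integrable (fun ω =>
      (quenched ψ (m N) (k N) (fun a => w a ω) - E N) ^ 6) P := fun N => by
    refine integrable_of_abs_le (((hqm N).sub_const _).pow_const 6) (2 ^ 6) fun ω => ?_
    rw [abs_pow]
    refine pow_le_pow_left₀ (abs_nonneg _) ((abs_sub _ _).trans ?_) 6
    linarith [hEb N, abs_quenched_le hψ1 (m N) (k N) (fun a => w a ω)]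
  filter_upwards [ae_tendsto_zero_of_summable_integral hint
    (fun N ω => Even.pow_nonneg (by decide) _) hsum] with ω hω
  have := (tendsto_zero_of_pow hω).add hE
  simpa using this

end Environment

/-! ### The quenched central limit theorem -/

/-- Lower bounds for both side lengths of the rectangle in terms of its perimeter. -/
lemma eventually_aspect {ξ : ℝ} (hξ : 0 < ξ) :
    ∃ c : ℝ, 0 < c ∧ ∀ᶠ N : ℕ in atTop, 1 ≤ ⌊ξ * N⌋₊ ∧
      c * ((⌊ξ * N⌋₊ : ℝ) + N) ≤ ⌊ξ * N⌋₊ ∧ c * ((⌊ξ * N⌋₊ : ℝ) + N) ≤ N := by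
  -- From `M ≤ ξ N` one gets `M + N ≤ (1 + ξ) N`; once `ξ N ≥ 2`, also `M ≥ ξ N / 2`.
  refine ⟨min (1 / (1 + ξ)) (ξ / (2 * (1 + ξ))), by positivity, ?_⟩
  have ht : Tendsto (fun N : ℕ => ξ * (N : ℝ)) atTop atTop :=
    tendsto_natCast_atTop_atTop.const_mul_atTop hξ
  filter_upwards [ht.eventually_ge_atTop 2] with N hN
  have h1 : (⌊ξ * N⌋₊ : ℝ) ≤ ξ * N := Nat.floor_le (by linarith)
  have h2 : ξ * N < ⌊ξ * N⌋₊ + 1 := Nat.lt_floor_add_one _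
  have h0 : (0 : ℝ) ≤ (⌊ξ * N⌋₊ : ℝ) + N := by positivity
  refine ⟨?_, ?_, ?_⟩
  · rw [Nat.one_le_floor_iff]; linarith
  · refine (mul_le_mul_of_nonneg_right (min_le_right _ _) h0).trans ?_
    rw [div_mul_eq_mul_div, div_le_iff₀ (by positivity)]
    have h3 : ξ * N ≤ 2 * ⌊ξ * N⌋₊ := by linarith
    nlinarith
  · refine (mul_le_mul_of_nonneg_right (min_le_left _ _) h0).trans ?_
    rw [div_mul_eq_mul_div, div_le_iff₀ (by positivity)]
    linarith

lemma pow_six_le_one_add_rpow {p : ℝ} (hp : 6 ≤ p) (x : ℝ) : x ^ 6 ≤ 1 + |x| ^ p := by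
  have e : x ^ 6 = |x| ^ 6 := (Even.pow_abs (by decide) x).symm
  rw [e]
  have h0 : 0 ≤ |x| ^ p := Real.rpow_nonneg (abs_nonneg x) p
  rcases le_total |x| 1 with h | h
  · linarith [pow_le_one₀ (abs_nonneg x) h (n := 6)]
  · have : |x| ^ (6 : ℝ) ≤ |x| ^ p := Real.rpow_le_rpow_of_exponent_le h hp
    rw [Real.rpow_ofNat] at this
    linarith

theorem theorem1p1
    -- the random environment
    {Ωw : Type*} [MeasurableSpace Ωw] (Pw : Measure Ωw) [IsProbabilityMeasure Pw]
    (w : ℕ+ × ℕ+ → Ωw → ℝ)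
    (hw_meas : ∀ a, Measurable (w a))
    (hw_indep : iIndepFun w Pw)
    (p K : ℝ) (hp : 12 < p)
    (hw_mean : ∀ a, ∫ ω, w a ω ∂Pw = 0)
    (hw_var : ∀ a, ∫ ω, (w a ω) ^ 2 ∂Pw = 1)
    (hw_mom : ∀ a, Integrable (fun ω => |w a ω| ^ p) Pw ∧ ∫ ω, |w a ω| ^ p ∂Pw ≤ K)
    -- the random paths; nothing but measurability is required for the finitely many `N` for
    -- which `⌊ξ N⌋ = 0`, where there is no path
    (ξ : ℝ) (hξ : 0 < ξ)
    {Ωσ : ℕ → Type*} [∀ N, MeasurableSpace (Ωσ N)] (Pσ : ∀ N, Measure (Ωσ N))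
    [∀ N, IsProbabilityMeasure (Pσ N)]
    (σ : ∀ N, Ωσ N → Finset (ℕ+ × ℕ+))
    (hσ_meas : ∀ (N : ℕ) π, MeasurableSet {s | σ N s = π})
    (hσ_unif : ∀ N : ℕ, 1 ≤ ⌊ξ * N⌋₊ → IsUniformUpRightPath ⌊ξ * N⌋₊ N (Pσ N) (σ N)) :
    ∀ᵐ ω ∂Pw,
      TendstoInDistribution
        (fun (N : ℕ) (s : Ωσ N) =>
          (√((⌊ξ * N⌋₊ : ℝ) + N - 1))⁻¹ * pathEnergy (fun a => w a ω) (σ N s))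
        atTop (id : ℝ → ℝ) Pσ (gaussianReal 0 1) := by
  -- A non-integrable function has integral 0 by convention, so variance 1 forces integrability.
  have hi2 : ∀ a, Integrable (fun ω => w a ω ^ 2) Pw := fun a => by
    by_contra h
    have := hw_var a
    rw [integral_undef h] at this
    exact zero_ne_one this
  have hi6 : ∀ a, Integrable (fun ω => w a ω ^ 6) Pw := fun a => by
    refine ((integrable_const (1 : ℝ)).add (hw_mom a).1).mono'
      ((hw_meas a).pow_const 6).aestronglyMeasurable (ae_of_all _ fun ω => ?_)
    rw [Real.norm_of_nonneg (Even.pow_nonneg (by decide) _)]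
    exact pow_six_le_one_add_rpow (by linarith) _
  have h6 : ∀ a, ∫ ω, w a ω ^ 6 ∂Pw ≤ 1 + K := fun a => by
    have := integral_mono (hi6 a) ((integrable_const (1 : ℝ)).add (hw_mom a).1)
      fun ω => pow_six_le_one_add_rpow (by linarith) (w a ω)
    rw [integral_add' (integrable_const _) (hw_mom a).1] at this
    simp only [integral_const, probReal_univ, smul_eq_mul, mul_one] at this
    linarith [(hw_mom a).2]
  have hK : 0 ≤ K := (integral_nonneg fun ω => Real.rpow_nonneg (abs_nonneg _) p).trans
    (hw_mom (1, 1)).2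
  obtain ⟨c, hc, hasp⟩ := eventually_aspect hξ
  -- The numbers of right and up steps are one less than the side lengths; the truncated
  -- subtractions are exact for large `N`.
  set m : ℕ → ℕ := fun N => ⌊ξ * N⌋₊ - 1 with hm
  set k : ℕ → ℕ := fun N => N - 1 with hk
  have hev : ∀ᶠ N : ℕ in atTop, ⌊ξ * N⌋₊ = m N + 1 ∧ N = k N + 1 := by
    filter_upwards [hasp, eventually_ge_atTop 1] with N h1 h2
    simp only [hm, hk]
    lia
  have hae : ∀ᵐ ω ∂Pw, ∀ j, Tendsto (fun N => quenched (testFun j) (m N) (k N) (fun a => w a ω))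
      atTop (nhds (∫ x, testFun j x ∂(gaussianReal 0 1))) := by
    -- Countability of the index type of `testFun` makes the exceptional null set independent of
    -- `j`.
    refine ae_all_iff.2 fun j => ?_
    refine ae_tendsto_quenched hw_meas hw_indep (by linarith : 1 ≤ 1 + K) hw_mean hi2 hw_var hi6 h6
      (by positivity) (abs_testFun_sub_le j) (abs_testFun_le_one j) hc ?_ ?_ ?_
    · filter_upwards [hev] with N h
      lia
    · filter_upwards [hev, hasp] with N h h'
      have e1 : (⌊ξ * N⌋₊ : ℝ) = m N + 1 := by exact_mod_cast h.1
      have e2 : (N : ℝ) = k N + 1 := by exact_mod_cast h.2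
      rw [e1, e2] at h'
      convert h'.2.1 using 2
      ring
    · filter_upwards [hev, hasp] with N h h'
      have e1 : (⌊ξ * N⌋₊ : ℝ) = m N + 1 := by exact_mod_cast h.1
      have e2 : (N : ℝ) = k N + 1 := by exact_mod_cast h.2
      rw [e1, e2] at h'
      convert h'.2.2 using 2
      ring
  filter_upwards [hae] with ω hω
  have hX : ∀ N, Measurable fun s : Ωσ N =>
      (√((⌊ξ * N⌋₊ : ℝ) + N - 1))⁻¹ * pathEnergy (fun a => w a ω) (σ N s) := fun N => by
    -- There are countably many finite sets of squares, so measurable level sets make `σ N`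
    -- measurable for the discrete σ-algebra.
    let _ : MeasurableSpace (Finset (ℕ+ × ℕ+)) := ⊤
    have hσ : Measurable (σ N) := measurable_to_countable' fun π => hσ_meas N π
    exact (measurable_from_top (f := fun π : Finset (ℕ+ × ℕ+) =>
      (√((⌊ξ * N⌋₊ : ℝ) + N - 1))⁻¹ * pathEnergy (fun a => w a ω) π)).comp hσ
  refine ⟨fun N => (hX N).aemeasurable, aemeasurable_id, ?_⟩
  refine tendsto_of_forall_integral_testFun fun j => ?_
  simp only [ProbabilityMeasure.coe_mk, Measure.map_id]
  refine (hω j).congr' ?_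
  filter_upwards [hev, hasp] with N h h'
  rw [integral_map (hX N).aemeasurable (continuous_testFun j).aestronglyMeasurable]
  have hu := hσ_unif N h'.1
  have e1 : (⌊ξ * N⌋₊ : ℝ) = m N + 1 := by exact_mod_cast h.1
  have e2 : (N : ℝ) = k N + 1 := by exact_mod_cast h.2
  have hu' : IsUniformUpRightPath (m N + 1) (k N + 1) (Pσ N) (σ N) := by
    rw [← h.1, ← h.2]
    exact hu
  rw [hu'.integral_eq (hσ_meas N) (fun π => testFun j
    ((√((⌊ξ * N⌋₊ : ℝ) + N - 1))⁻¹ * pathEnergy (fun a => w a ω) π)), quenched]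
  have e3 : (⌊ξ * N⌋₊ : ℝ) + N - 1 = m N + k N + 1 := by rw [e1, e2]; ring
  rw [e3]
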